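/- Let $A\in\mathbb{R}^{n\times n}$ and let $\Delta=\{p\in\mathbb{R}^n : p_i\ge 0,\ \sum_{i=1}^n p_i=1\}$. For $p\in\mathbb{R}^n$ and $T>0$ put $$\widetilde W(p;T)=\int_0^T e^{At}\,\mathrm{diag}(p)\,e^{A^\top t}\,dt .$$ The finite-horizon VCS problem with terminal time $T$ is: minimize $-\log\det\widetilde W(p;T)$ subject to $p\in\Delta$, $\widetilde W(p;T)\succ O$. Let $Q^{-1}AQ=J=\mathrm{diag}(J_1,\dots,J_m)$ be any Jordan decomposition of $A$ over $\mathbb{C}$, where $J_i=\lambda_iI_{n_i}+N_{n_i}$ (the nilpotent block $N_{n_i}$ has ones on the superdiagonal) and the blocks are grouped as $J=\mathrm{diag}(J_-,J_0,J_+)$, where $J_-$, $J_0$, $J_+$ consist of the blocks with $\mathrm{Re}\,\lambda_i<0$, $=0$, $>0$, respectively (each group may be empty). For $p\in\mathbb{R}^n$ let $\widetilde B=Q^{-1}\mathrm{diag}(p)Q^{-*}$, with diagonal blocks $\widetilde B_{-,-},\widetilde B_{0,0},\widetilde B_{+,+}$ for this grouping. Let $W_-(p)$ and $W_+(p)$ be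 the unique solutions of $$J_-W_-(p)+W_-(p)J_-^*+\widetilde B_{-,-}=O,\qquad (-J_+)W_+(p)+W_+(p)(-J_+^*)+\widetilde B_{+,+}=O .$$ Let $W_0(p)$ be the matrix of the size of $J_0$ whose block for Jordan blocks $i,j$ of $J_0$ is $\widetilde b_{i,j}C_{i,j}$ if $\lambda_i=\lambda_j$ and $O$ otherwise, where $\widetilde b_{i,j}$ is the lower-right entry of the corresponding $n_i\times n_j$ block of $\widetilde B$, and $C_{i,j}\in\mathbb{R}^{n_i\times n_j}$ has the entries $$(C_{i,j})_{a,b}=\frac{1}{(n_i-a)!\,(n_j-b)!\,(n_i-a+n_j-b+1)}\qquad(1\le a\le n_i,\ 1\le b\le n_j).$$ Put $W_\infty(p)=\mathrm{diag}(W_-(p),W_0(p),W_+(p))$. The infinite-horizon VCS problem is: minimize $-\log\det W_\infty(p)$ subject to $p\in\Delta$, $W_\infty(p)\succ O$. **Theorem.** Assume that the infinite-horizon VCS problem has a unique optimal solution $p^\infty_{\mathrm{VCS}}$. Then for every $T>0$ the finite-horizon VCS problem has an optimal solution, and for every choice of optimal solutions $p^T_{\mathrm{VCS}}$ of the finite-horizon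 problems ($T>0$), $$p^T_{\mathrm{VCS}}\to p^\infty_{\mathrm{VCS}}\qquad\text{as } T\to\infty .$$ -/

import Mathlib

open Matrix Filter Topology
open scoped ComplexOrder Nat

noncomputable section

/-! ### Finite-horizon problem -/

/-- The finite-horizon controllability Gramian
`∫₀ᵀ exp(At) diag(p) exp(Aᵀt) dt`, the integral of a matrix being taken entrywise. -/
def gramian {n : ℕ} (A : Matrix (Fin n) (Fin n) ℝ) (p : Fin n → ℝ) (T : ℝ) :
    Matrix (Fin n) (Fin n) ℝ :=
  Matrix.of fun i j =>
    ∫ t in (0 : ℝ)..T,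
      (NormedSpace.exp (t • A) * Matrix.diagonal p * NormedSpace.exp (t • Aᵀ)) i j

/-- The feasible set `{p ∈ Δ | W̃(p;T) ≻ O}` of the finite-horizon problem. -/
def vcsFeasible {n : ℕ} (A : Matrix (Fin n) (Fin n) ℝ) (T : ℝ) : Set (Fin n → ℝ) :=
  {p | p ∈ stdSimplex ℝ (Fin n) ∧ (gramian A p T).PosDef}

/-- `p` is an optimal solution of the finite-horizon VCS problem with terminal time `T`. -/
def IsVCS {n : ℕ} (A : Matrix (Fin n) (Fin n) ℝ) (T : ℝ) (p : Fin n → ℝ) : Prop :=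
  p ∈ vcsFeasible A T ∧
    IsMinOn (fun q => -Real.log (gramian A q T).det) (vcsFeasible A T) p

/-! ### Jordan decompositions -/

/-- The Jordan block `λ I_k + N_k`, with ones on the superdiagonal. -/
def jordanBlock (lam : ℂ) (k : ℕ) : Matrix (Fin k) (Fin k) ℂ :=
  Matrix.of fun a b => if a = b then lam else if (a : ℕ) + 1 = b then 1 else 0

/-- The data of a finite (possibly empty) list of Jordan blocks: their sizes and eigenvalues. -/
structure JordanData where
  count : ℕ
  size : Fin count → ℕ
  size_pos : ∀ i, 0 < size i
  eig : Fin count → ℂ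

/-- Row and column indices of a block-diagonal Jordan matrix: `⟨i, a⟩` is position `a` in
block `i`. -/
abbrev JordanData.Idx (b : JordanData) : Type := Σ i : Fin b.count, Fin (b.size i)

/-- The block-diagonal matrix with the given Jordan blocks. -/
def JordanData.mat (b : JordanData) : Matrix b.Idx b.Idx ℂ :=
  Matrix.blockDiagonal' fun i => jordanBlock (b.eig i) (b.size i)

/-- The index of the last row of block `i`. -/
def JordanData.last (b : JordanData) (i : Fin b.count) : b.Idx :=
  ⟨i, ⟨b.size i - 1, Nat.sub_lt (b.size_pos i) one_pos⟩⟩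

/-- A Jordan decomposition `Q⁻¹ A Q = diag(J₋, J₀, J₊)` of a real square matrix `A`, where the
blocks are grouped according to the sign of the real parts of their eigenvalues.
Inside each group the order of the blocks is arbitrary. -/
structure JordanDecomposition {n : ℕ} (A : Matrix (Fin n) (Fin n) ℝ) where
  neg : JordanData
  zero : JordanData
  pos : JordanData
  re_neg : ∀ i, (neg.eig i).re < 0
  re_zero : ∀ i, (zero.eig i).re = 0
  re_pos : ∀ i, 0 < (pos.eig i).re
  Q : Matrix (Fin n) (neg.Idx ⊕ (zero.Idx ⊕ pos.Idx)) ℂ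
  Qinv : Matrix (neg.Idx ⊕ (zero.Idx ⊕ pos.Idx)) (Fin n) ℂ
  Q_mul_Qinv : Q * Qinv = 1
  Qinv_mul_Q : Qinv * Q = 1
  conj_eq : Qinv * A.map (fun x : ℝ => (x : ℂ)) * Q =
    Matrix.fromBlocks neg.mat 0 0 (Matrix.fromBlocks zero.mat 0 0 pos.mat)

/-! ### Sylvester equations -/

/-- If no eigenvalues `μ₁` of `C₁` and `μ₂` of `C₂` have `μ₁ + μ₂ = 0`, the Sylvester equation
`C₁ Y + Y C₂ + P = 0` has exactly one solution. -/
theorem sylvester_existsUnique {ι κ : Type*} [Fintype ι] [DecidableEq ι] [Fintype κ]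
    [DecidableEq κ] (C₁ : Matrix ι ι ℂ) (C₂ : Matrix κ κ ℂ)
    (h : ∀ μ₁ ∈ spectrum ℂ C₁, ∀ μ₂ ∈ spectrum ℂ C₂, μ₁ + μ₂ ≠ 0) (P : Matrix ι κ ℂ) :
    ∃! Y : Matrix ι κ ℂ, C₁ * Y + Y * C₂ + P = 0 := by
  let L : Matrix ι κ ℂ →ₗ[ℂ] Matrix ι κ ℂ :=
    { toFun := fun Y => C₁ * Y + Y * C₂
      map_add' := fun X Y => by rw [Matrix.mul_add, Matrix.add_mul]; abel
      map_smul' := fun c X => by simp [smul_add] }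
  have hL : ∀ Y, L Y = C₁ * Y + Y * C₂ := fun _ => rfl
  have hinj : Function.Injective L := by
    rw [injective_iff_map_eq_zero]
    intro Y hY
    have h1 : C₁ * Y = Y * (-C₂) := by
      rw [Matrix.mul_neg]; exact eq_neg_of_add_eq_zero_left hY
    have hpow : ∀ k : ℕ, C₁ ^ k * Y = Y * (-C₂) ^ k := by
      intro k
      induction k with
      | zero => simp
      | succ k ih => rw [pow_succ, Matrix.mul_assoc, h1, ← Matrix.mul_assoc, ih,
          Matrix.mul_assoc, ← pow_succ]
    have hpoly : ∀ p : Polynomial ℂ,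
        Polynomial.aeval C₁ p * Y = Y * Polynomial.aeval (-C₂) p := by
      intro p
      induction p using Polynomial.induction_on' with
      | add p q hp hq => rw [map_add, map_add, Matrix.add_mul, Matrix.mul_add, hp, hq]
      | monomial k a =>
        rw [Polynomial.aeval_monomial, Polynomial.aeval_monomial, ← Algebra.smul_def,
          ← Algebra.smul_def, Matrix.smul_mul, Matrix.mul_smul, hpow]
    have h2 := hpoly C₁.charpoly
    rw [Matrix.aeval_self_charpoly, Matrix.zero_mul] at h2
    have hunit : IsUnit (Polynomial.aeval (-C₂) C₁.charpoly) := by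
      by_contra hn
      rw [(IsAlgClosed.splits C₁.charpoly).eq_prod_roots_of_monic
        (Matrix.charpoly_monic C₁)] at hn
      obtain ⟨k, hk, hroot⟩ := spectrum.exists_mem_of_not_isUnit_aeval_prod hn
      have hk' : -k ∈ spectrum ℂ C₂ := by
        rw [← spectrum.neg_eq] at hk
        simpa using hk
      exact h k (Matrix.mem_spectrum_iff_isRoot_charpoly.2 hroot) (-k) hk' (by simp)
    obtain ⟨u, hu⟩ := hunit
    have h3 : Y * (u : Matrix κ κ ℂ) * ((u⁻¹ : (Matrix κ κ ℂ)ˣ) : Matrix κ κ ℂ) = 0 := by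
      rw [hu, ← h2, Matrix.zero_mul]
    rwa [Matrix.mul_assoc, Units.mul_inv, Matrix.mul_one] at h3
  have hsurj : Function.Surjective L := LinearMap.injective_iff_surjective.1 hinj
  obtain ⟨Y, hY⟩ := hsurj (-P)
  refine ⟨Y, ?_, ?_⟩
  · change L Y + P = 0
    rw [hY]; simp
  · intro Z hZ
    apply hinj
    rw [hY]
    exact eq_neg_of_add_eq_zero_left hZ

/-- The eigenvalues of a block-diagonal Jordan matrix are those of its blocks. -/
theorem JordanData.spectrum_mat (b : JordanData) {μ : ℂ} (hμ : μ ∈ spectrum ℂ b.mat) :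
    ∃ i, μ = b.eig i := by
  rw [← Matrix.spectrum_toLin', ← Module.End.hasEigenvalue_iff_mem_spectrum] at hμ
  obtain ⟨v, hv⟩ := hμ.exists_hasEigenvector
  have hne : ∃ x, v x ≠ 0 := Function.ne_iff.1 hv.2
  have hmul : b.mat *ᵥ v = μ • v := by simpa using hv.apply_eq_smul
  obtain ⟨⟨i, a₀⟩, ha₀⟩ := hne
  obtain ⟨a, ha, hmax⟩ : ∃ a, v ⟨i, a⟩ ≠ 0 ∧ ∀ c, a < c → v ⟨i, c⟩ = 0 := by
    let s : Finset (Fin (b.size i)) := Finset.univ.filter fun a => v ⟨i, a⟩ ≠ 0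
    have hs : s.Nonempty := ⟨a₀, by simp [s, ha₀]⟩
    refine ⟨s.max' hs, ?_, fun c hc => ?_⟩
    · simpa [s] using s.max'_mem hs
    · by_contra hc0
      exact absurd (s.le_max' c (by simp [s, hc0])) (not_le.2 hc)
  refine ⟨i, ?_⟩
  have h1 := congrFun hmul ⟨i, a⟩
  have h2 : (b.mat *ᵥ v) ⟨i, a⟩ = b.eig i * v ⟨i, a⟩ := by
    rw [Matrix.mulVec, dotProduct, Finset.sum_eq_single (⟨i, a⟩ : b.Idx)]
    · simp [JordanData.mat, jordanBlock]
    · rintro ⟨j, c⟩ - hjc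
      by_cases hij : i = j
      · subst hij
        have hac : a ≠ c := fun e => hjc (by rw [e])
        by_cases hsucc : (a : ℕ) + 1 = c
        · rw [hmax c (Fin.lt_def.2 (by omega)), mul_zero]
        · simp [JordanData.mat, jordanBlock, hac, hsucc]
      · simp [JordanData.mat, Matrix.blockDiagonal'_apply_ne _ _ _ hij]
    · simp
  rw [h2, Pi.smul_apply, smul_eq_mul] at h1
  exact (mul_right_cancel₀ ha h1).symm

/-- Likewise for the conjugate transpose. -/
theorem JordanData.spectrum_mat_conjTranspose (b : JordanData) {μ : ℂ}
    (hμ : μ ∈ spectrum ℂ b.matᴴ) : ∃ i, μ = star (b.eig i) := by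
  rw [← Matrix.star_eq_conjTranspose, spectrum.map_star, Set.mem_star] at hμ
  obtain ⟨i, hi⟩ := b.spectrum_mat hμ
  exact ⟨i, by rw [← hi, star_star]⟩

namespace JordanDecomposition

variable {n : ℕ} {A : Matrix (Fin n) (Fin n) ℝ} (D : JordanDecomposition A)

/-- The index type of the Jordan form `J = diag(J₋, J₀, J₊)`. -/
abbrev Idx : Type := D.neg.Idx ⊕ (D.zero.Idx ⊕ D.pos.Idx)

theorem existsUnique_neg (P : Matrix D.neg.Idx D.neg.Idx ℂ) :
    ∃! Y : Matrix D.neg.Idx D.neg.Idx ℂ, D.neg.mat * Y + Y * D.neg.matᴴ + P = 0 := by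
  refine sylvester_existsUnique _ _ (fun μ₁ h₁ μ₂ h₂ h => ?_) P
  obtain ⟨i, rfl⟩ := D.neg.spectrum_mat h₁
  obtain ⟨j, rfl⟩ := D.neg.spectrum_mat_conjTranspose h₂
  have h' := congrArg Complex.re h
  simp at h'
  linarith [D.re_neg i, D.re_neg j]

theorem existsUnique_pos (P : Matrix D.pos.Idx D.pos.Idx ℂ) :
    ∃! Y : Matrix D.pos.Idx D.pos.Idx ℂ,
      (-D.pos.mat) * Y + Y * (-D.pos.matᴴ) + P = 0 := by
  refine sylvester_existsUnique _ _ (fun μ₁ h₁ μ₂ h₂ h => ?_) P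
  rw [← spectrum.neg_eq, Set.mem_neg] at h₁ h₂
  obtain ⟨i, hi⟩ := D.pos.spectrum_mat h₁
  obtain ⟨j, hj⟩ := D.pos.spectrum_mat_conjTranspose h₂
  have h' := congrArg Complex.re h
  have hi' := congrArg Complex.re hi
  have hj' := congrArg Complex.re hj
  simp at h' hi' hj'
  linarith [D.re_pos i, D.re_pos j]

/-! ### The infinite-horizon scaled controllability Gramian -/

/-- `B̃ = Q⁻¹ B Q⁻*`. -/
def tilde (B : Matrix (Fin n) (Fin n) ℂ) : Matrix D.Idx D.Idx ℂ :=
  D.Qinv * B * D.Qinvᴴ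

/-- `W₋(B)`: the unique solution of `J₋ W + W J₋* + B̃₋₋ = O`. -/
def WNeg (B : Matrix (Fin n) (Fin n) ℂ) : Matrix D.neg.Idx D.neg.Idx ℂ :=
  (D.existsUnique_neg (D.tilde B).toBlocks₁₁).choose

/-- `W₊(B)`: the unique solution of `(-J₊) W + W (-J₊*) + B̃₊₊ = O`. -/
def WPos (B : Matrix (Fin n) (Fin n) ℂ) : Matrix D.pos.Idx D.pos.Idx ℂ :=
  (D.existsUnique_pos (D.tilde B).toBlocks₂₂.toBlocks₂₂).choose

/-- `W₀(B)`: for blocks `i`, `j` with the same imaginary eigenvalue, the `(i,j)`-block is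
`b̃ᵢⱼ Cᵢⱼ`, where `b̃ᵢⱼ` is the lower-right entry of the `(i,j)`-block of `B̃` and, counting rows
and columns from `0`, `Cᵢⱼ` has entries
`1 / ((nᵢ-1-a)! (nⱼ-1-b)! ((nᵢ-1-a) + (nⱼ-1-b) + 1))`; here `a.rev = nᵢ-1-a`.
For blocks with distinct eigenvalues it is zero. -/
def WZero (B : Matrix (Fin n) (Fin n) ℂ) : Matrix D.zero.Idx D.zero.Idx ℂ :=
  Matrix.of fun x y =>
    if D.zero.eig x.1 = D.zero.eig y.1 then
      (D.tilde B).toBlocks₂₂.toBlocks₁₁ (D.zero.last x.1) (D.zero.last y.1) *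
        (1 / (((x.2.rev : ℕ)! : ℂ) * ((y.2.rev : ℕ)! : ℂ) *
          ((x.2.rev : ℕ) + (y.2.rev : ℕ) + 1 : ℂ)))
    else 0

/-- `W_∞(p) = diag(W₋, W₀, W₊)` evaluated at `B = diag(p)`. -/
def WInf (p : Fin n → ℝ) : Matrix D.Idx D.Idx ℂ :=
  let B : Matrix (Fin n) (Fin n) ℂ := Matrix.diagonal fun i => (p i : ℂ)
  Matrix.fromBlocks (D.WNeg B) 0 0 (Matrix.fromBlocks (D.WZero B) 0 0 (D.WPos B))

/-- The feasible set `{p ∈ Δ | W_∞(p) ≻ O}` of the infinite-horizon problem. -/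
def feasible : Set (Fin n → ℝ) :=
  {p | p ∈ stdSimplex ℝ (Fin n) ∧ (D.WInf p).PosDef}

/-- `p` is an optimal solution of the infinite-horizon VCS problem. On the feasible set the
complex number `det W_∞(p)` is real and positive, so it equals its real part. -/
def IsInfVCS (p : Fin n → ℝ) : Prop :=
  p ∈ D.feasible ∧ IsMinOn (fun q => -Real.log (D.WInf q).det.re) D.feasible p

end JordanDecomposition

end

/-! Pass to Jordan coordinates and rescale rows depending on `T`. The rows of `exp (t J)` for `J₋`
are kept. Those for `J₀` are multiplied by `T^(-1/2-r)`, where `r` is the distance of the row from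
the bottom of its block, and those for `J₊` by `exp (-T J₊)`. The Gramian undergoes a congruence
that does not involve `p`, so its determinant is multiplied by a positive factor depending on `T`
alone (`exists_det_scaledGramian_eq`) and the optimal solutions are unchanged.

The scaled Gramian converges to `W_∞(p)` (`tendsto_scaledGramian`). For `J₋` and `J₊` it satisfies
the Sylvester equation up to an exponentially small boundary term. For `J₀` its entries are
normalized moments `∫ e^(μt) t^k dt`, of which only the non-oscillating ones of top degree survive.
The mixed blocks vanish because the three kinds of rows concentrate near `t = 0`, spread out at
height `T^(-1/2)`, and concentrate near `t = T`. Linearity in `p` makes the convergence joint in `p`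
and `T` (`tendsto_scaledW_of_tendsto`).

On the simplex all Gramians are positive semidefinite, so both problems maximize a determinant over
a compact set, provided that its maximum is positive. Inequalities between determinants pass to the
limit, so every cluster point of finite-horizon optima solves the infinite-horizon problem
(`isInfVCS_of_mapClusterPt`); uniqueness and compactness give convergence. For existence, `pInf` has
a positive definite Gramian for some large horizon, hence for every positive one by analyticity
(`posDef_gramian_of_posDef`). -/

noncomputable section

/-! ### Entrywise derivatives and the matrix exponential -/

/-- A matrix-valued function of a real variable is differentiable entry by entry. -/
def HasEntrywiseDerivAt {ι κ : Type*} (f : ℝ → Matrix ι κ ℂ) (f' : Matrix ι κ ℂ) (t : ℝ) : Prop :=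
  ∀ i j, HasDerivAt (fun s => f s i j) (f' i j) t

namespace HasEntrywiseDerivAt

variable {ι κ μ : Type*} {f : ℝ → Matrix ι κ ℂ} {f' : Matrix ι κ ℂ} {t : ℝ}

theorem mul [Fintype κ] {g : ℝ → Matrix κ μ ℂ} {g' : Matrix κ μ ℂ} (hf : HasEntrywiseDerivAt f f' t)
    (hg : HasEntrywiseDerivAt g g' t) :
    HasEntrywiseDerivAt (fun s => f s * g s) (f' * g t + f t * g') t := by
  intro i j
  simp only [Matrix.mul_apply, Matrix.add_apply, ← Finset.sum_add_distrib]
  exact HasDerivAt.fun_sum fun k _ => (hf i k).mul (hg k j)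

theorem mul_const [Fintype κ] (hf : HasEntrywiseDerivAt f f' t) (C : Matrix κ μ ℂ) :
    HasEntrywiseDerivAt (fun s => f s * C) (f' * C) t := by
  have h := hf.mul (g := fun _ => C) (g' := 0) fun i j => hasDerivAt_const t (C i j)
  simpa using h

theorem const_mul [Fintype κ] {g : ℝ → Matrix κ μ ℂ} {g' : Matrix κ μ ℂ} (C : Matrix ι κ ℂ)
    (hg : HasEntrywiseDerivAt g g' t) :
    HasEntrywiseDerivAt (fun s => C * g s) (C * g') t := by
  have h := HasEntrywiseDerivAt.mul (f := fun _ => C) (f' := 0)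
    (fun i j => hasDerivAt_const t (C i j)) hg
  simpa using h

theorem conjTranspose (hf : HasEntrywiseDerivAt f f' t) :
    HasEntrywiseDerivAt (fun s => (f s)ᴴ) f'ᴴ t :=
  fun i j => (hf j i).star

end HasEntrywiseDerivAt

section Exponential

variable {ι : Type*} [Fintype ι] [DecidableEq ι]

open scoped Matrix.Norms.Operator in
theorem hasDerivAt_exp_smul_apply {𝕜 : Type*} [RCLike 𝕜] (M : Matrix ι ι 𝕜) (t : ℝ) (i j : ι) :
    HasDerivAt (fun s : ℝ => NormedSpace.exp (s • M) i j)
      ((NormedSpace.exp (t • M) * M) i j) t := by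
  have h := hasDerivAt_exp_smul_const (𝕂 := ℝ) M t
  exact hasDerivAt_pi.1 (hasDerivAt_pi.1 h i) j

theorem hasEntrywiseDerivAt_exp_smul (M : Matrix ι ι ℂ) (t : ℝ) :
    HasEntrywiseDerivAt (fun s : ℝ => NormedSpace.exp (s • M)) (NormedSpace.exp (t • M) * M) t :=
  hasDerivAt_exp_smul_apply M t

-- Analyticity feeds the identity theorem by which controllability is independent of the horizon.
open scoped Matrix.Norms.Operator in
theorem analyticAt_exp_smul_apply (M : Matrix ι ι ℝ) (t : ℝ) (i j : ι) :
    AnalyticAt ℝ (fun s : ℝ => NormedSpace.exp (s • M) i j) t := by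
  have h1 : AnalyticAt ℝ (NormedSpace.exp : Matrix ι ι ℝ → Matrix ι ι ℝ) (t • M) :=
    NormedSpace.exp_analytic (𝕂 := ℝ) (t • M)
  have h2 : AnalyticAt ℝ (fun s : ℝ => NormedSpace.exp (s • M)) t :=
    h1.comp_of_eq (by fun_prop) rfl
  let L : Matrix ι ι ℝ →ₗ[ℝ] ℝ := Matrix.entryLinearMap ℝ ℝ i j
  exact (L.toContinuousLinearMap.analyticAt _).comp h2

/-- The exponential is the only solution of `E' = E M`, `E 0 = 1`. -/
theorem eq_exp_smul_of_hasEntrywiseDerivAt {M : Matrix ι ι ℂ} {E : ℝ → Matrix ι ι ℂ}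
    (hE : ∀ t, HasEntrywiseDerivAt E (E t * M) t) (h0 : E 0 = 1) (t : ℝ) :
    E t = NormedSpace.exp (t • M) := by
  have hneg (t : ℝ) : HasEntrywiseDerivAt (fun s : ℝ => NormedSpace.exp (-(s • M)))
      (-(M * NormedSpace.exp (-(t • M)))) t := by
    have h := hasEntrywiseDerivAt_exp_smul (-M) t
    -- Moving `M` to the left of its exponential lets it cancel the factor `E M` in the product rule
    -- below.
    have hc : Commute M (NormedSpace.exp (t • -M)) :=
      (((Commute.refl M).neg_right).smul_right t).exp_right
    rw [Matrix.mul_neg, ← hc.eq] at h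
    simpa using h
  have hconst (i j : ι) : (E t * NormedSpace.exp (-(t • M))) i j = (1 : Matrix ι ι ℂ) i j := by
    have hd (s : ℝ) : HasDerivAt (fun s => (E s * NormedSpace.exp (-(s • M))) i j) 0 s := by
      have h := (hE s).mul (hneg s) i j
      simpa [Matrix.mul_assoc] using h
    have := is_const_of_deriv_eq_zero (fun s => (hd s).differentiableAt) (fun s => (hd s).deriv) t 0
    rw [this]
    simp [h0]
  have h1 : E t * NormedSpace.exp (-(t • M)) = 1 := by ext i j; exact hconst i j
  have h2 : NormedSpace.exp (-(t • M)) * NormedSpace.exp (t • M) = 1 := by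
    rw [← Matrix.exp_add_of_commute _ _ ((Commute.refl (t • M)).neg_left), neg_add_cancel,
      NormedSpace.exp_zero]
  rw [← Matrix.mul_one (E t), ← h2, ← Matrix.mul_assoc, h1, Matrix.one_mul]

end Exponential

/-! ### Entrywise integrals of matrix-valued functions -/

/-- The entrywise integral over `[0, T]` of a matrix-valued function. -/
def entrywiseIntegral {ι κ : Type*} (f : ℝ → Matrix ι κ ℂ) (T : ℝ) : Matrix ι κ ℂ :=
  Matrix.of fun i j => ∫ t in (0 : ℝ)..T, f t i j

section EntrywiseIntegral

variable {ι κ μ : Type*}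

theorem const_mul_entrywiseIntegral [Fintype κ] (C : Matrix ι κ ℂ) {f : ℝ → Matrix κ μ ℂ}
    (hf : Continuous f) (T : ℝ) :
    C * entrywiseIntegral f T = entrywiseIntegral (fun t => C * f t) T := by
  ext i j
  simp only [entrywiseIntegral, Matrix.mul_apply, Matrix.of_apply]
  rw [intervalIntegral.integral_finsetSum]
  · simp
  · intro k _
    exact (continuous_const.mul (hf.matrix_elem k j)).intervalIntegrable _ _

theorem entrywiseIntegral_mul_const [Fintype κ] (C : Matrix κ μ ℂ) {f : ℝ → Matrix ι κ ℂ}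
    (hf : Continuous f) (T : ℝ) :
    entrywiseIntegral f T * C = entrywiseIntegral (fun t => f t * C) T := by
  ext i j
  simp only [entrywiseIntegral, Matrix.mul_apply, Matrix.of_apply]
  rw [intervalIntegral.integral_finsetSum]
  · simp
  · intro k _
    exact ((hf.matrix_elem i k).mul continuous_const).intervalIntegrable _ _

theorem entrywiseIntegral_add {f g : ℝ → Matrix ι κ ℂ} (hf : Continuous f) (hg : Continuous g)
    (T : ℝ) :
    entrywiseIntegral f T + entrywiseIntegral g T = entrywiseIntegral (fun t => f t + g t) T := by
  ext i j
  simp only [entrywiseIntegral, Matrix.add_apply, Matrix.of_apply]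
  rw [intervalIntegral.integral_add] <;> apply Continuous.intervalIntegrable
  · exact hf.matrix_elem i j
  · exact hg.matrix_elem i j

theorem entrywiseIntegral_eq_sub {f f' : ℝ → Matrix ι κ ℂ}
    (hf : ∀ t, HasEntrywiseDerivAt f (f' t) t) (hf' : Continuous f') (T : ℝ) :
    entrywiseIntegral f' T = f T - f 0 := by
  ext i j
  exact intervalIntegral.integral_eq_sub_of_hasDerivAt (fun t _ => hf t i j)
    ((hf'.matrix_elem i j).intervalIntegrable _ _)

end EntrywiseIntegral

/-! ### The exponential of a Jordan matrix -/

/-- The exponential `exp (t J)` of a block-diagonal Jordan matrix, given by its entries. -/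
def JordanData.expMat (b : JordanData) (t : ℝ) : Matrix b.Idx b.Idx ℂ :=
  Matrix.of fun x y =>
    if x.1 = y.1 ∧ (x.2 : ℕ) ≤ y.2 then
      Complex.exp (t * b.eig x.1) * ((t : ℂ) ^ ((y.2 : ℕ) - x.2) / (((y.2 : ℕ) - x.2)! : ℂ))
    else 0

namespace JordanData

variable (b : JordanData)

theorem expMat_zero : b.expMat 0 = 1 := by
  ext ⟨i, a⟩ ⟨j, c⟩
  by_cases hij : i = j
  · subst hij
    rcases lt_trichotomy (a : ℕ) c with h | h | h
    · have : (c : ℕ) - a ≠ 0 := by omega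
      have hac : a ≠ c := by rintro rfl; omega
      simp [expMat, this, hac]
    · obtain rfl : a = c := Fin.ext h
      simp [expMat]
    · have hac : a ≠ c := by rintro rfl; omega
      have h' : ¬ (a ≤ c) := by rw [Fin.le_def]; omega
      simp [expMat, h', hac]
  · simp [expMat, hij]

/-- A column of a Jordan matrix has its eigenvalue on the diagonal and a `1` just above it, except
that the first column of a block has no such `1`. -/
theorem expMat_mul_mat_apply (t : ℝ) (x : b.Idx) (j : Fin b.count) (c : Fin (b.size j)) :
    (b.expMat t * b.mat) x ⟨j, c⟩ = b.expMat t x ⟨j, c⟩ * b.eig j +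
      if h : 0 < (c : ℕ) then b.expMat t x ⟨j, ⟨c - 1, by omega⟩⟩ else 0 := by
  have hmat (y : b.Idx) : b.mat y ⟨j, c⟩ = (if y = ⟨j, c⟩ then b.eig j else 0) +
      if h : 0 < (c : ℕ) then (if y = ⟨j, ⟨c - 1, by omega⟩⟩ then 1 else 0) else 0 := by
    obtain ⟨i, a⟩ := y
    by_cases hij : i = j
    · subst hij
      simp only [mat, Matrix.blockDiagonal'_apply_eq, jordanBlock, Matrix.of_apply, Sigma.mk.injEq,
        heq_eq_eq, true_and, Fin.ext_iff]
      split_ifs <;> first | omega | simp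
    · simp [mat, Matrix.blockDiagonal'_apply_ne _ _ _ hij, hij]
  simp only [Matrix.mul_apply, hmat, mul_add, Finset.sum_add_distrib]
  congr 1
  · simp
  · split_ifs <;> simp

theorem hasEntrywiseDerivAt_expMat (t : ℝ) :
    HasEntrywiseDerivAt b.expMat (b.expMat t * b.mat) t := by
  rintro ⟨i, a⟩ ⟨j, c⟩
  rw [expMat_mul_mat_apply]
  simp only [expMat, Matrix.of_apply]
  by_cases hij : i = j
  swap
  · simp [hij, hasDerivAt_const]
  subst hij
  have hexp : HasDerivAt (fun s : ℝ => Complex.exp (s * b.eig i))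
      (Complex.exp (t * b.eig i) * b.eig i) t := by
    have h1 : HasDerivAt (fun s : ℝ => (s : ℂ) * b.eig i) (b.eig i) t := by
      simpa using (Complex.ofRealCLM.hasDerivAt (x := t)).mul_const (b.eig i)
    exact h1.cexp
  by_cases hac : (a : ℕ) ≤ c
  swap
  · have : ¬ ((a : ℕ) ≤ c - 1) := by omega
    simp [hac, this, hasDerivAt_const]
  obtain ⟨k, hk⟩ := Nat.exists_eq_add_of_le hac
  have hk' : (c : ℕ) - a = k := by omega
  -- Here `k` is the distance above the diagonal. For `k = 0` the entry to the left lies below the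
  -- diagonal and vanishes; otherwise the product rule for `e^(λt) t^(k+1)/(k+1)!` yields the two
  -- terms.
  rcases k with _ | k
  · have h1 : ¬ (0 < (c : ℕ) ∧ (a : ℕ) ≤ c - 1) := by omega
    have h2 : (if h : 0 < (c : ℕ) then (if (a : ℕ) ≤ c - 1 then
        Complex.exp (t * b.eig i) * ((t : ℂ) ^ ((c : ℕ) - 1 - a) / (((c : ℕ) - 1 - a)! : ℂ))
        else 0) else 0) = 0 := by
      split_ifs <;> first | rfl | (exfalso; omega)
    simp only [hac, true_and, if_true, h2, hk', add_zero]
    simpa using hexp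
  · have h1 : 0 < (c : ℕ) := by omega
    have h2 : (a : ℕ) ≤ c - 1 := by omega
    have h3 : (c : ℕ) - 1 - a = k := by omega
    simp only [hac, true_and, if_true, h1, dif_pos, h2, hk', h3]
    have hpow : HasDerivAt (fun s : ℝ => (s : ℂ) ^ (k + 1) / ((k + 1)! : ℂ))
        ((t : ℂ) ^ k / (k ! : ℂ)) t := by
      have h := ((hasDerivAt_pow (k + 1) (t : ℂ)).comp_ofReal).div_const ((k + 1)! : ℂ)
      refine h.congr_deriv ?_
      have : (k ! : ℂ) ≠ 0 := by exact_mod_cast k.factorial_ne_zero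
      have : (k + 1 : ℂ) ≠ 0 := by exact_mod_cast k.succ_ne_zero
      rw [Nat.factorial_succ]
      push_cast
      field_simp
    refine (hexp.mul hpow).congr_deriv ?_
    ring

theorem expMat_eq (t : ℝ) : b.expMat t = NormedSpace.exp (t • b.mat) :=
  eq_exp_smul_of_hasEntrywiseDerivAt b.hasEntrywiseDerivAt_expMat b.expMat_zero t

theorem continuous_expMat : Continuous b.expMat :=
  continuous_matrix fun i j =>
    continuous_iff_continuousAt.2 fun t => (b.hasEntrywiseDerivAt_expMat t i j).continuousAt

theorem expMat_add (s t : ℝ) : b.expMat (s + t) = b.expMat s * b.expMat t := by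
  simp only [expMat_eq, add_smul]
  exact Matrix.exp_add_of_commute _ _ (((Commute.refl b.mat).smul_left s).smul_right t)

theorem expMat_mul_mat (t : ℝ) : b.expMat t * b.mat = b.mat * b.expMat t := by
  rw [expMat_eq]
  exact ((((Commute.refl b.mat).smul_right t).exp_right).eq).symm

/-- Exponential decay: a factor `exp (δ t)` absorbs the polynomial growth. -/
theorem norm_expMat_le (x y : b.Idx) {δ : ℝ} (hδ : 0 < δ) :
    ∃ C, 0 ≤ C ∧ ∀ t, ‖b.expMat t x y‖ ≤ C * Real.exp (t * (b.eig x.1).re + δ * |t|) := by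
  refine ⟨(δ⁻¹) ^ ((y.2 : ℕ) - x.2), by positivity, fun t => ?_⟩
  simp only [expMat, Matrix.of_apply]
  split_ifs
  swap
  · simp; positivity
  rw [norm_mul, Complex.norm_exp, norm_div, norm_pow, Complex.norm_real, Complex.norm_natCast]
  -- The bound `s^k / k! ≤ e^s` at `s = δ|t|` explains the constant `δ^(-k)`.
  have h1 := Real.pow_div_factorial_le_exp (δ * |t|) (by positivity) ((y.2 : ℕ) - x.2)
  have h2 : |t| ^ ((y.2 : ℕ) - x.2) / (((y.2 : ℕ) - x.2)! : ℝ) =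
      δ⁻¹ ^ ((y.2 : ℕ) - x.2) * ((δ * |t|) ^ ((y.2 : ℕ) - x.2) / (((y.2 : ℕ) - x.2)! : ℝ)) := by
    rw [mul_pow, inv_pow]; field_simp
  rw [Real.norm_eq_abs, h2, Real.exp_add, Complex.re_ofReal_mul]
  calc _ ≤ Real.exp (t * (b.eig x.1).re) * (δ⁻¹ ^ ((y.2 : ℕ) - x.2) * Real.exp (δ * |t|)) := by
        gcongr
    _ = _ := by ring

end JordanData

/-! ### Limits of integrals over growing intervals -/

theorem tendsto_integral_zero_of_norm_le {f : ℝ → ℝ → ℂ} {g : ℝ → ℝ → ℝ}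
    (hg : ∀ T, Continuous (g T))
    (hfg : ∀ T, 1 ≤ T → ∀ t, 0 ≤ t → t ≤ T → ‖f T t‖ ≤ g T t)
    (hlim : Tendsto (fun T => ∫ t in (0 : ℝ)..T, g T t) atTop (𝓝 0)) :
    Tendsto (fun T => ∫ t in (0 : ℝ)..T, f T t) atTop (𝓝 0) := by
  refine squeeze_zero_norm' ?_ hlim
  filter_upwards [eventually_ge_atTop (1 : ℝ)] with T hT
  refine intervalIntegral.norm_integral_le_of_norm_le (by linarith) ?_
    ((hg T).intervalIntegrable _ _)
  exact Eventually.of_forall fun t ht => hfg T hT t ht.1.le ht.2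

theorem integral_exp_neg_mul_le {α : ℝ} (hα : 0 < α) (T : ℝ) :
    ∫ t in (0 : ℝ)..T, Real.exp (-(α * t)) ≤ α⁻¹ := by
  have hd (t : ℝ) : HasDerivAt (fun t => -α⁻¹ * Real.exp (-(α * t))) (Real.exp (-(α * t))) t := by
    have h1 : HasDerivAt (fun t : ℝ => -(α * t)) (-α) t := by
      simpa using (hasDerivAt_const_mul α (x := t)).fun_neg
    refine (h1.exp.const_mul (-α⁻¹)).congr_deriv ?_
    field_simp
  rw [intervalIntegral.integral_eq_sub_of_hasDerivAt (fun t _ => hd t)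
    (Continuous.intervalIntegrable (by fun_prop) _ _)]
  have : 0 < α⁻¹ * Real.exp (-(α * T)) := by positivity
  simp
  linarith

theorem integral_exp_neg_mul_sub_le {α : ℝ} (hα : 0 < α) (T : ℝ) :
    ∫ t in (0 : ℝ)..T, Real.exp (-(α * (T - t))) ≤ α⁻¹ := by
  rw [intervalIntegral.integral_comp_sub_left (fun t => Real.exp (-(α * t))) T]
  simpa using integral_exp_neg_mul_le hα T

/-- `f T t` decays exponentially in `t ∈ [0, T]`. -/
def DecaysForward (f : ℝ → ℝ → ℂ) : Prop :=
  ∃ C α : ℝ, 0 ≤ C ∧ 0 < α ∧ ∀ T, 1 ≤ T → ∀ t, 0 ≤ t → t ≤ T →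
    ‖f T t‖ ≤ C * Real.exp (-(α * t))

/-- `f T t` decays exponentially in `T - t` for `t ∈ [0, T]`. -/
def DecaysBackward (f : ℝ → ℝ → ℂ) : Prop :=
  ∃ C α : ℝ, 0 ≤ C ∧ 0 < α ∧ ∀ T, 1 ≤ T → ∀ t, 0 ≤ t → t ≤ T →
    ‖f T t‖ ≤ C * Real.exp (-(α * (T - t)))

/-- `f T t` is bounded by a multiple of `1 / √T` for `t ∈ [0, T]`. -/
def DecaysSqrt (f : ℝ → ℝ → ℂ) : Prop :=
  ∃ C : ℝ, 0 ≤ C ∧ ∀ T, 1 ≤ T → ∀ t, 0 ≤ t → t ≤ T → ‖f T t‖ ≤ C * (√T)⁻¹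

theorem DecaysForward.star {f : ℝ → ℝ → ℂ} (hf : DecaysForward f) :
    DecaysForward fun T t => star (f T t) := by
  simpa [DecaysForward] using hf

theorem DecaysBackward.star {f : ℝ → ℝ → ℂ} (hf : DecaysBackward f) :
    DecaysBackward fun T t => star (f T t) := by
  simpa [DecaysBackward] using hf

theorem DecaysSqrt.star {f : ℝ → ℝ → ℂ} (hf : DecaysSqrt f) :
    DecaysSqrt fun T t => star (f T t) := by
  simpa [DecaysSqrt] using hf

theorem tendsto_inv_sqrt_mul_const (c : ℝ) :
    Tendsto (fun T : ℝ => (√T)⁻¹ * c) atTop (𝓝 0) := by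
  simpa using (tendsto_inv_atTop_zero.comp Real.tendsto_sqrt_atTop).mul_const c

/-- The exponential has integral at most `1/α` whatever `T` is, so the factor `1/√T` is left over.
-/
theorem DecaysForward.tendsto_integral_mul_sqrt {f g : ℝ → ℝ → ℂ} (hf : DecaysForward f)
    (hg : DecaysSqrt g) :
    Tendsto (fun T => ∫ t in (0 : ℝ)..T, f T t * g T t) atTop (𝓝 0) := by
  obtain ⟨C, α, hC, hα, hf⟩ := hf
  obtain ⟨C', hC', hg⟩ := hg
  refine tendsto_integral_zero_of_norm_le
    (g := fun T t => (√T)⁻¹ * (C * C') * Real.exp (-(α * t))) (fun T => by fun_prop) ?_ ?_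
  · intro T hT t h0 h1
    rw [norm_mul]
    calc _ ≤ (C * Real.exp (-(α * t))) * (C' * (√T)⁻¹) := by
          gcongr
          · exact hf T hT t h0 h1
          · exact hg T hT t h0 h1
      _ = _ := by ring
  · refine squeeze_zero' ?_ ?_ (tendsto_inv_sqrt_mul_const (C * C' * α⁻¹))
    · filter_upwards [eventually_ge_atTop (0 : ℝ)] with T hT
      exact intervalIntegral.integral_nonneg hT fun t _ => by positivity
    · refine Eventually.of_forall fun T => ?_
      rw [intervalIntegral.integral_const_mul]
      exact (mul_le_mul_of_nonneg_left (integral_exp_neg_mul_le hα T) (by positivity)).trans_eq (by ring)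

theorem DecaysBackward.tendsto_integral_mul_sqrt {f g : ℝ → ℝ → ℂ} (hf : DecaysBackward f)
    (hg : DecaysSqrt g) :
    Tendsto (fun T => ∫ t in (0 : ℝ)..T, f T t * g T t) atTop (𝓝 0) := by
  obtain ⟨C, α, hC, hα, hf⟩ := hf
  obtain ⟨C', hC', hg⟩ := hg
  refine tendsto_integral_zero_of_norm_le
    (g := fun T t => (√T)⁻¹ * (C * C') * Real.exp (-(α * (T - t)))) (fun T => by fun_prop) ?_ ?_
  · intro T hT t h0 h1
    rw [norm_mul]
    calc _ ≤ (C * Real.exp (-(α * (T - t)))) * (C' * (√T)⁻¹) := by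
          gcongr
          · exact hf T hT t h0 h1
          · exact hg T hT t h0 h1
      _ = _ := by ring
  · refine squeeze_zero' ?_ ?_ (tendsto_inv_sqrt_mul_const (C * C' * α⁻¹))
    · filter_upwards [eventually_ge_atTop (0 : ℝ)] with T hT
      exact intervalIntegral.integral_nonneg hT fun t _ => by positivity
    · refine Eventually.of_forall fun T => ?_
      rw [intervalIntegral.integral_const_mul]
      exact (mul_le_mul_of_nonneg_left (integral_exp_neg_mul_sub_le hα T) (by positivity)).trans_eq (by ring)

/-- With the smaller rate `γ` in both factors the exponents `t` and `T - t` add up to `T`, so the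
integral is `O(T e^(-γT))`. -/
theorem DecaysForward.tendsto_integral_mul_backward {f g : ℝ → ℝ → ℂ} (hf : DecaysForward f)
    (hg : DecaysBackward g) :
    Tendsto (fun T => ∫ t in (0 : ℝ)..T, f T t * g T t) atTop (𝓝 0) := by
  obtain ⟨C, α, hC, hα, hf⟩ := hf
  obtain ⟨C', β, hC', hβ, hg⟩ := hg
  have hγ : 0 < min α β := lt_min hα hβ
  refine tendsto_integral_zero_of_norm_le
    (g := fun T _ => C * C' * Real.exp (-(min α β * T))) (fun T => by fun_prop) ?_ ?_
  · intro T hT t h0 h1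
    rw [norm_mul]
    calc _ ≤ (C * Real.exp (-(min α β * t))) * (C' * Real.exp (-(min α β * (T - t)))) := by
          refine mul_le_mul ((hf T hT t h0 h1).trans ?_) ((hg T hT t h0 h1).trans ?_)
            (norm_nonneg _) (by positivity)
          · have := min_le_left α β
            gcongr
          · have := min_le_right α β
            have : 0 ≤ T - t := by linarith
            gcongr
      _ = C * C' * (Real.exp (-(min α β * t)) * Real.exp (-(min α β * (T - t)))) := by ring
      _ = _ := by rw [← Real.exp_add]; ring_nf
  · have h1 : Tendsto (fun T : ℝ => min α β * T) atTop atTop := tendsto_id.const_mul_atTop hγ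
    have h2 := ((Real.tendsto_pow_mul_exp_neg_atTop_nhds_zero 1).comp h1).const_mul
      (C * C' * (min α β)⁻¹)
    rw [mul_zero] at h2
    refine h2.congr fun T => ?_
    simp only [Function.comp, intervalIntegral.integral_const, smul_eq_mul, pow_one]
    field_simp
    ring

/-! ### Normalized oscillating moments -/

/-- The moment `∫₀ᵀ e^{μ t} t ^ k dt` with imaginary `μ ≠ 0` grows at most like `T ^ k`. -/
theorem exists_norm_integral_exp_mul_pow_le {μ : ℂ} (hre : μ.re = 0) (hμ : μ ≠ 0) (k : ℕ) :
    ∃ C, 0 ≤ C ∧ ∀ T : ℝ, 1 ≤ T →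
      ‖∫ t in (0 : ℝ)..T, Complex.exp (t * μ) * (t : ℂ) ^ k‖ ≤ C * T ^ k := by
  have hexp (t : ℝ) : ‖Complex.exp (t * μ)‖ = 1 := by
    rw [Complex.norm_exp, Complex.re_ofReal_mul, hre, mul_zero, Real.exp_zero]
  have hd (t : ℝ) : HasDerivAt (fun t : ℝ => Complex.exp (t * μ) / μ) (Complex.exp (t * μ)) t := by
    have h1 : HasDerivAt (fun s : ℝ => (s : ℂ) * μ) μ t := by
      simpa using (Complex.ofRealCLM.hasDerivAt (x := t)).mul_const μ
    refine (h1.cexp.div_const μ).congr_deriv ?_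
    field_simp
  have hμn : 0 < ‖μ‖ := norm_pos_iff.2 hμ
  induction k with
  | zero =>
    refine ⟨2 / ‖μ‖, by positivity, fun T _ => ?_⟩
    simp only [pow_zero, mul_one]
    rw [intervalIntegral.integral_eq_sub_of_hasDerivAt (fun t _ => hd t)
      (Continuous.intervalIntegrable (by fun_prop) _ _)]
    refine (norm_sub_le _ _).trans ?_
    rw [norm_div, norm_div, hexp, hexp]
    exact le_of_eq (by ring)
  | succ k ih =>
    obtain ⟨C, hC, ih⟩ := ih
    -- Integration by parts: the first summand bounds the boundary term, the second the remaining
    -- moment, where `T ^ k ≤ T ^ (k + 1)` because `1 ≤ T`.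
    refine ⟨1 / ‖μ‖ + (k + 1) / ‖μ‖ * C, by positivity, fun T hT => ?_⟩
    have hpow (t : ℝ) : HasDerivAt (fun s : ℝ => (s : ℂ) ^ (k + 1)) ((k + 1 : ℂ) * (t : ℂ) ^ k) t := by
      simpa using (hasDerivAt_pow (k + 1) (t : ℂ)).comp_ofReal
    have hparts : ∫ t in (0 : ℝ)..T, Complex.exp (t * μ) * (t : ℂ) ^ (k + 1) =
        Complex.exp (T * μ) / μ * (T : ℂ) ^ (k + 1) -
          (k + 1) / μ * ∫ t in (0 : ℝ)..T, Complex.exp (t * μ) * (t : ℂ) ^ k := by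
      have h := intervalIntegral.integral_eq_sub_of_hasDerivAt (a := 0) (b := T)
        (fun t _ => (hd t).mul (hpow t)) (Continuous.intervalIntegrable (by fun_prop) _ _)
      rw [intervalIntegral.integral_add (Continuous.intervalIntegrable (by fun_prop) _ _)
        (Continuous.intervalIntegrable (by fun_prop) _ _)] at h
      rw [eq_sub_iff_add_eq, ← intervalIntegral.integral_const_mul]
      simp only [Pi.mul_apply, Complex.ofReal_zero, ne_eq, Nat.add_eq_zero_iff, one_ne_zero,
        and_false, not_false_eq_true, zero_pow, mul_zero, sub_zero] at h
      rw [← h]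
      congr 2
      ext t
      ring
    rw [hparts]
    refine (norm_sub_le _ _).trans ?_
    rw [norm_mul, norm_mul, norm_div, norm_div, hexp, norm_pow, Complex.norm_real,
      Real.norm_of_nonneg (by linarith : (0 : ℝ) ≤ T)]
    have hk : ‖(k + 1 : ℂ)‖ = k + 1 := by exact_mod_cast Complex.norm_natCast (k + 1)
    rw [hk, add_mul, mul_assoc _ C]
    gcongr
    refine (ih T hT).trans ?_
    gcongr
    · omega

/-- Without oscillation the moment is `T^(k+1)/(k+1)`, which matches the normalization only for `k =
K`. Oscillation costs one power of `T`, so nothing survives. -/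
theorem tendsto_integral_exp_mul_pow_div {μ : ℂ} (hre : μ.re = 0) {k K : ℕ} (hk : k ≤ K) :
    Tendsto (fun T : ℝ => ((T : ℂ) ^ (K + 1))⁻¹ *
        ∫ t in (0 : ℝ)..T, Complex.exp (t * μ) * (t : ℂ) ^ k) atTop
      (𝓝 (if μ = 0 ∧ k = K then 1 / (K + 1 : ℂ) else 0)) := by
  by_cases hμ : μ = 0
  · subst hμ
    have hint (T : ℝ) : ∫ t in (0 : ℝ)..T, Complex.exp (t * 0) * (t : ℂ) ^ k =
        (T : ℂ) ^ (k + 1) / (k + 1) := by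
      simp only [mul_zero, Complex.exp_zero, one_mul]
      simp_rw [← Complex.ofReal_pow]
      rw [intervalIntegral.integral_ofReal, integral_pow]
      push_cast
      simp
    simp only [hint, true_and]
    rcases hk.eq_or_lt with rfl | hlt
    · rw [if_pos rfl]
      refine tendsto_const_nhds.congr' ?_
      filter_upwards [eventually_gt_atTop (0 : ℝ)] with T hT
      have : (T : ℂ) ≠ 0 := by exact_mod_cast hT.ne'
      field_simp
    · rw [if_neg hlt.ne]
      have h := (tendsto_pow_neg_atTop (𝕜 := ℝ) (n := K - k) (by omega)).ofReal
      have h' := h.mul_const (1 / (k + 1 : ℂ))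
      simp only [Complex.ofReal_zero, zero_mul] at h'
      refine Tendsto.congr' ?_ (by simpa using h')
      filter_upwards [eventually_gt_atTop (0 : ℝ)] with T hT
      have : (T : ℂ) ≠ 0 := by exact_mod_cast hT.ne'
      obtain ⟨d, rfl⟩ := Nat.exists_eq_add_of_le hk
      have : k + d - k = d := by omega
      rw [this]
      have : (k + 1 : ℂ) ≠ 0 := by exact_mod_cast k.succ_ne_zero
      field_simp
      ring
  · rw [if_neg (fun h => hμ h.1)]
    obtain ⟨C, hC, hle⟩ := exists_norm_integral_exp_mul_pow_le hre hμ k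
    have h : Tendsto (fun T : ℝ => T⁻¹ * C) atTop (𝓝 0) := by
      simpa using tendsto_inv_atTop_zero.mul_const C
    refine squeeze_zero_norm' ?_ h
    filter_upwards [eventually_ge_atTop (1 : ℝ)] with T hT
    have hT0 : 0 < T := by linarith
    rw [norm_mul, norm_inv, norm_pow, Complex.norm_real, Real.norm_of_nonneg hT0.le]
    calc _ ≤ (T ^ (K + 1))⁻¹ * (C * T ^ K) := by
          gcongr
          refine (hle T hT).trans ?_
          gcongr
      _ = _ := by field_simp; ring

/-! ### Limits of matrix-valued functions -/

theorem tendsto_matrix_iff {α ι κ : Type*} {l : Filter α} {f : α → Matrix ι κ ℂ}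
    {M : Matrix ι κ ℂ} :
    Tendsto f l (𝓝 M) ↔ ∀ i j, Tendsto (fun a => f a i j) l (𝓝 (M i j)) :=
  tendsto_pi_nhds.trans (forall_congr' fun _ => tendsto_pi_nhds)

/-- A family of approximate solutions of an invertible Sylvester equation converges to the
solution. -/
theorem tendsto_choose_of_sylvester {ι κ α : Type*} [Fintype ι] [Fintype κ] {l : Filter α}
    {C₁ : Matrix ι ι ℂ} {C₂ : Matrix κ κ ℂ}
    (h : ∀ P : Matrix ι κ ℂ, ∃! Y : Matrix ι κ ℂ, C₁ * Y + Y * C₂ + P = 0)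
    {P : Matrix ι κ ℂ} {S : α → Matrix ι κ ℂ}
    (hS : Tendsto (fun a => C₁ * S a + S a * C₂ + P) l (𝓝 0)) :
    Tendsto S l (𝓝 (h P).choose) := by
  let L : Matrix ι κ ℂ →ₗ[ℂ] Matrix ι κ ℂ :=
    { toFun := fun Y => C₁ * Y + Y * C₂
      map_add' := fun X Y => by rw [Matrix.mul_add, Matrix.add_mul]; abel
      map_smul' := fun c X => by simp [smul_add] }
  have hL : ∀ Y, L Y = C₁ * Y + Y * C₂ := fun _ => rfl
  have hinj : Function.Injective L := by
    intro Y Z hYZ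
    refine (h (-(L Y))).unique ?_ ?_
    · rw [← hL]; exact add_neg_cancel _
    · rw [← hL, hYZ]; exact add_neg_cancel _
  let e := LinearEquiv.ofInjectiveEndo L hinj
  have he : ∀ Y, e Y = L Y := fun _ => rfl
  -- Unique solvability makes the Sylvester operator a linear automorphism of a finite-dimensional
  -- space, so its inverse is continuous.
  have hcont : Continuous e.symm :=
    LinearMap.continuous_of_finiteDimensional (e.symm : Matrix ι κ ℂ →ₗ[ℂ] Matrix ι κ ℂ)
  have h1 : Tendsto (fun a => e (S a)) l (𝓝 (e (h P).choose)) := by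
    have hW : e (h P).choose = 0 - P := by
      rw [he, hL, zero_sub]
      exact eq_neg_of_add_eq_zero_left (h P).choose_spec.1
    rw [hW]
    refine (hS.sub_const P).congr fun a => ?_
    rw [he, hL, add_sub_cancel_right]
  simpa [Function.comp_def] using (hcont.tendsto _).comp h1

theorem DecaysForward.tendsto_diagonal {f : ℝ → ℝ → ℂ} (hf : DecaysForward f) :
    Tendsto (fun T => f T T) atTop (𝓝 0) := by
  obtain ⟨C, α, -, hα, hf⟩ := hf
  have h1 : Tendsto (fun T : ℝ => α * T) atTop atTop := tendsto_id.const_mul_atTop hα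
  have h2 := (Real.tendsto_exp_neg_atTop_nhds_zero.comp h1).const_mul C
  rw [mul_zero] at h2
  refine squeeze_zero_norm' ?_ h2
  filter_upwards [eventually_ge_atTop (1 : ℝ)] with T hT
  exact hf T hT T (by linarith) le_rfl

theorem DecaysBackward.tendsto_zero {f : ℝ → ℝ → ℂ} (hf : DecaysBackward f) :
    Tendsto (fun T => f T 0) atTop (𝓝 0) := by
  obtain ⟨C, α, -, hα, hf⟩ := hf
  have h1 : Tendsto (fun T : ℝ => α * T) atTop atTop := tendsto_id.const_mul_atTop hα
  have h2 := (Real.tendsto_exp_neg_atTop_nhds_zero.comp h1).const_mul C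
  rw [mul_zero] at h2
  refine squeeze_zero_norm' ?_ h2
  filter_upwards [eventually_ge_atTop (1 : ℝ)] with T hT
  simpa using hf T hT 0 le_rfl (by linarith)

theorem tendsto_mul_mul_conjTranspose_zero {ι α : Type*} [Fintype ι] {l : Filter α}
    {E : α → Matrix ι ι ℂ} (hE : Tendsto E l (𝓝 0)) (B : Matrix ι ι ℂ) :
    Tendsto (fun a => E a * B * (E a)ᴴ) l (𝓝 0) := by
  have hc : Continuous fun M : Matrix ι ι ℂ => M * B * Mᴴ := by fun_prop
  simpa [Function.comp_def] using (hc.tendsto 0).comp hE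

/-! ### Decay of Jordan exponentials, and Gramians of Jordan matrices -/

namespace JordanData

variable (b : JordanData)

theorem decaysForward_expMat (h : ∀ i, (b.eig i).re < 0) (x y : b.Idx) :
    DecaysForward fun _ t => b.expMat t x y := by
  have hx := h x.1
  -- Half of the decay rate is spent on absorbing the polynomial factor.
  obtain ⟨C, hC, hle⟩ := b.norm_expMat_le x y (δ := -(b.eig x.1).re / 2) (by linarith)
  refine ⟨C, -(b.eig x.1).re / 2, hC, by linarith, fun T _ t h0 _ => (hle t).trans_eq ?_⟩
  rw [abs_of_nonneg h0]
  ring_nf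

theorem decaysBackward_expMat (h : ∀ i, 0 < (b.eig i).re) (x y : b.Idx) :
    DecaysBackward fun T t => b.expMat (t - T) x y := by
  have hx := h x.1
  obtain ⟨C, hC, hle⟩ := b.norm_expMat_le x y (δ := (b.eig x.1).re / 2) (by linarith)
  refine ⟨C, (b.eig x.1).re / 2, hC, by linarith, fun T _ t _ h1 => (hle _).trans_eq ?_⟩
  rw [abs_of_nonpos (by linarith)]
  ring_nf

/-- The shift `c` allows one computation for both groups: `c = 0` serves `J₋` and `c = T` serves
`J₊`. -/
theorem hasEntrywiseDerivAt_gramIntegrand (B : Matrix b.Idx b.Idx ℂ) (c t : ℝ) :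
    HasEntrywiseDerivAt (fun s => b.expMat (s - c) * B * (b.expMat (s - c))ᴴ)
      (b.mat * (b.expMat (t - c) * B * (b.expMat (t - c))ᴴ) +
        b.expMat (t - c) * B * (b.expMat (t - c))ᴴ * b.matᴴ) t := by
  have h1 : HasEntrywiseDerivAt (fun s => b.expMat (s - c)) (b.mat * b.expMat (t - c)) t := by
    rw [← expMat_mul_mat]
    exact fun i j => (b.hasEntrywiseDerivAt_expMat (t - c) i j).comp_sub_const t c
  have h := (h1.mul_const B).mul h1.conjTranspose
  convert h using 1
  rw [Matrix.conjTranspose_mul]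
  simp only [Matrix.mul_assoc]

/-- The Sylvester identity for the finite-horizon Gramian of a Jordan matrix. -/
theorem sylvester_gramIntegral (B : Matrix b.Idx b.Idx ℂ) (c T : ℝ) :
    b.mat * entrywiseIntegral (fun t => b.expMat (t - c) * B * (b.expMat (t - c))ᴴ) T +
      entrywiseIntegral (fun t => b.expMat (t - c) * B * (b.expMat (t - c))ᴴ) T * b.matᴴ =
    b.expMat (T - c) * B * (b.expMat (T - c))ᴴ - b.expMat (-c) * B * (b.expMat (-c))ᴴ := by
  have hE : Continuous fun t => b.expMat (t - c) :=
    b.continuous_expMat.comp (continuous_id.sub continuous_const)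
  have hX : Continuous fun t => b.expMat (t - c) * B * (b.expMat (t - c))ᴴ :=
    (hE.matrix_mul continuous_const).matrix_mul hE.matrix_conjTranspose
  rw [const_mul_entrywiseIntegral _ hX, entrywiseIntegral_mul_const _ hX,
    entrywiseIntegral_add (continuous_const.matrix_mul hX) (hX.matrix_mul continuous_const),
    entrywiseIntegral_eq_sub (b.hasEntrywiseDerivAt_gramIntegrand B c)
      ((continuous_const.matrix_mul hX).add (hX.matrix_mul continuous_const)), zero_sub]

/-- The growth rate of the rows of `exp (t J)` for eigenvalues on the imaginary axis, normalized
so that the integral of the product of two rows stays bounded. -/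
def rowScale (T : ℝ) (x : b.Idx) : ℝ := (√T)⁻¹ * (T ^ (x.2.rev : ℕ))⁻¹

theorem rowScale_pos {T : ℝ} (hT : 0 < T) (x : b.Idx) : 0 < b.rowScale T x := by
  unfold rowScale; positivity

theorem rowScale_mul_rowScale {T : ℝ} (hT : 0 < T) (x y : b.Idx) :
    b.rowScale T x * b.rowScale T y = (T ^ ((x.2.rev : ℕ) + y.2.rev + 1))⁻¹ := by
  have h : (√T)⁻¹ * (√T)⁻¹ = T⁻¹ := by rw [← mul_inv, Real.mul_self_sqrt hT.le]
  calc _ = ((√T)⁻¹ * (√T)⁻¹) * ((T ^ (x.2.rev : ℕ))⁻¹ * (T ^ (y.2.rev : ℕ))⁻¹) := by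
        unfold rowScale; ring
    _ = _ := by rw [h, pow_succ, pow_add]; field_simp

/-- The exponential factor has modulus one, and the highest power of `t` in row `x` is `x.2.rev`,
reached in the last column of its block. The scaling cancels this power and leaves `1/√T`. -/
theorem decaysSqrt_expMat (h : ∀ i, (b.eig i).re = 0) (x y : b.Idx) :
    DecaysSqrt fun T t => (b.rowScale T x : ℂ) * b.expMat t x y := by
  refine ⟨1, zero_le_one, fun T hT t h0 h1 => ?_⟩
  have hT0 : 0 < T := by linarith
  rw [norm_mul, Complex.norm_real, Real.norm_of_nonneg (b.rowScale_pos hT0 x).le, rowScale,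
    one_mul, mul_assoc]
  refine mul_le_of_le_one_right (by positivity) ?_
  rw [inv_mul_le_one₀ (by positivity)]
  simp only [expMat, Matrix.of_apply]
  split_ifs with hxy
  swap
  · simp; positivity
  rw [norm_mul, Complex.norm_exp, Complex.re_ofReal_mul, h, mul_zero, Real.exp_zero, one_mul,
    norm_div, norm_pow, Complex.norm_real, Complex.norm_natCast, Real.norm_of_nonneg h0]
  have hle : (y.2 : ℕ) - x.2 ≤ x.2.rev := by
    obtain ⟨i, a⟩ := x
    obtain ⟨j, c⟩ := y
    obtain ⟨rfl, -⟩ := hxy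
    simp only [Fin.val_rev]
    omega
  calc _ ≤ t ^ ((y.2 : ℕ) - x.2) := div_le_self (by positivity) (by exact_mod_cast Nat.factorial_pos _)
    _ ≤ T ^ ((y.2 : ℕ) - x.2) := by gcongr
    _ ≤ T ^ (x.2.rev : ℕ) := pow_le_pow_right₀ hT hle

/-- The limits of the normalized integrals of products of rows. -/
theorem tendsto_integral_rowScale (h : ∀ i, (b.eig i).re = 0) (x u y v : b.Idx) :
    Tendsto (fun T => ∫ t in (0 : ℝ)..T, (b.rowScale T x * b.expMat t x u) *
        star (b.rowScale T y * b.expMat t y v)) atTop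
      (𝓝 (if b.eig x.1 = b.eig y.1 ∧ u = b.last x.1 ∧ v = b.last y.1 then
        1 / (((x.2.rev : ℕ)! : ℂ) * ((y.2.rev : ℕ)! : ℂ) *
          ((x.2.rev : ℕ) + (y.2.rev : ℕ) + 1 : ℂ)) else 0)) := by
  obtain ⟨i, a⟩ := x
  obtain ⟨i', c⟩ := u
  obtain ⟨j, e⟩ := y
  obtain ⟨j', d⟩ := v
  -- If the entry of the exponential is zero, column `u` cannot be the last of block `i`, so the
  -- claimed limit is zero as well.
  by_cases hu : i = i' ∧ (a : ℕ) ≤ c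
  swap
  · have hne : (⟨i', c⟩ : b.Idx) ≠ b.last i := by
      rintro h
      obtain ⟨rfl, h⟩ := Sigma.mk.inj_iff.1 h
      have hc := Fin.ext_iff.1 (eq_of_heq h)
      simp only at hc
      exact hu ⟨rfl, by omega⟩
    simp [expMat, hu, hne]
  by_cases hv : j = j' ∧ (e : ℕ) ≤ d
  swap
  · have hne : (⟨j', d⟩ : b.Idx) ≠ b.last j := by
      rintro h
      obtain ⟨rfl, h⟩ := Sigma.mk.inj_iff.1 h
      have hc := Fin.ext_iff.1 (eq_of_heq h)
      simp only at hc
      exact hv ⟨rfl, by omega⟩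
    simp [expMat, hv, hne]
  obtain ⟨rfl, hac⟩ := hu
  obtain ⟨rfl, hed⟩ := hv
  have hk : ((c : ℕ) - a) + ((d : ℕ) - e) ≤ (a.rev : ℕ) + e.rev := by
    simp only [Fin.val_rev]; omega
  have hre : (b.eig i + star (b.eig j)).re = 0 := by simp [h]
  -- On the imaginary axis conjugation is negation, so the frequency of the product is the
  -- difference of the eigenvalues.
  have heig : b.eig i + star (b.eig j) = 0 ↔ b.eig i = b.eig j := by
    rw [Complex.ext_iff, Complex.ext_iff]
    simp [h, add_neg_eq_zero]
  have hlast (i : Fin b.count) (c : Fin (b.size i)) :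
      (⟨i, c⟩ : b.Idx) = b.last i ↔ (c : ℕ) = b.size i - 1 := by
    simp [last, Fin.ext_iff]
  have hlim := (tendsto_integral_exp_mul_pow_div hre hk).const_mul
    (1 / ((((c : ℕ) - a)! : ℂ) * (((d : ℕ) - e)! : ℂ)))
  refine Tendsto.congr' ?_ (hlim.trans_eq ?_)
  · filter_upwards [eventually_gt_atTop (0 : ℝ)] with T hT
    have hs := congrArg (fun r : ℝ => (r : ℂ)) (b.rowScale_mul_rowScale hT ⟨i, a⟩ ⟨j, e⟩)
    simp only [Complex.ofReal_mul, Complex.ofReal_inv, Complex.ofReal_pow] at hs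
    rw [← hs, ← mul_assoc, ← intervalIntegral.integral_const_mul]
    congr 1
    ext t
    simp only [expMat, Matrix.of_apply, hac, hed, and_self, if_true, star_mul', star_div₀, star_pow,
      Complex.star_def, Complex.conj_ofReal, ← Complex.exp_conj, map_mul, map_natCast, mul_add,
      Complex.exp_add, pow_add]
    ring
  -- Each exponent is at most the `rev` of its row, so the total degree is maximal exactly when both
  -- columns are last in their blocks.
  · have hiff : (b.eig i + star (b.eig j) = 0 ∧
        ((c : ℕ) - a) + ((d : ℕ) - e) = (a.rev : ℕ) + e.rev) ↔
        (b.eig i = b.eig j ∧ (⟨i, c⟩ : b.Idx) = b.last i ∧ (⟨j, d⟩ : b.Idx) = b.last j) := by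
      rw [heig, hlast, hlast]
      refine and_congr_right fun _ => ?_
      simp only [Fin.val_rev]
      omega
    by_cases hlim : b.eig i + star (b.eig j) = 0 ∧
        ((c : ℕ) - a) + ((d : ℕ) - e) = (a.rev : ℕ) + e.rev
    · obtain ⟨-, hc, hd⟩ := hiff.1 hlim
      rw [hlast] at hc hd
      have hca : (c : ℕ) - a = a.rev := by simp only [Fin.val_rev]; omega
      have hde : (d : ℕ) - e = e.rev := by simp only [Fin.val_rev]; omega
      rw [if_pos hlim, if_pos (hiff.1 hlim), hca, hde]
      push_cast
      rw [one_div_mul_one_div]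
    · rw [if_neg hlim, if_neg fun h => hlim (hiff.2 h), mul_zero]

end JordanData

namespace JordanDecomposition

variable {n : ℕ} {A : Matrix (Fin n) (Fin n) ℝ} (D : JordanDecomposition A)

/-! ### The scaled Gramian and its limit -/

/-- The exponential of the Jordan form, its rows being rescaled so that the Gramian over `[0, T]`
stays bounded. -/
def scaledExp (T t : ℝ) : Matrix D.Idx D.Idx ℂ :=
  Matrix.fromBlocks (D.neg.expMat t) 0 0
    (Matrix.fromBlocks (Matrix.of fun x y => D.zero.rowScale T x * D.zero.expMat t x y) 0 0
      (D.pos.expMat (t - T)))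

/-- The Gramian over `[0, T]` in scaled Jordan coordinates. -/
def scaledGramian (B : Matrix (Fin n) (Fin n) ℂ) (T : ℝ) : Matrix D.Idx D.Idx ℂ :=
  entrywiseIntegral (fun t => D.scaledExp T t * D.tilde B * (D.scaledExp T t)ᴴ) T

/-- The infinite-horizon Gramian for an arbitrary input matrix `B`. -/
def WInfOf (B : Matrix (Fin n) (Fin n) ℂ) : Matrix D.Idx D.Idx ℂ :=
  Matrix.fromBlocks (D.WNeg B) 0 0 (Matrix.fromBlocks (D.WZero B) 0 0 (D.WPos B))

theorem continuous_scaledExp (T : ℝ) : Continuous (D.scaledExp T) := by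
  have h1 := D.neg.continuous_expMat
  have h2 := D.zero.continuous_expMat
  have h3 : Continuous fun t => D.pos.expMat (t - T) :=
    D.pos.continuous_expMat.comp (continuous_id.sub continuous_const)
  refine h1.matrix_fromBlocks continuous_const continuous_const
    (Continuous.matrix_fromBlocks ?_ continuous_const continuous_const h3)
  exact continuous_matrix fun i j => continuous_const.mul (h2.matrix_elem i j)

/-- Linearity in `B̃` reduces entrywise limits to scalar integrals of products of entries from two
rows of the scaled exponential. -/
theorem scaledGramian_apply (B : Matrix (Fin n) (Fin n) ℂ) (T : ℝ) (x y : D.Idx) :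
    D.scaledGramian B T x y = ∑ u, ∑ v, D.tilde B u v *
      ∫ t in (0 : ℝ)..T, D.scaledExp T t x u * star (D.scaledExp T t y v) := by
  have hc (x u : D.Idx) : Continuous fun t => D.scaledExp T t x u :=
    (D.continuous_scaledExp T).matrix_elem x u
  have hint (u v : D.Idx) : IntervalIntegrable
      (fun t => D.tilde B u v * (D.scaledExp T t x u * star (D.scaledExp T t y v)))
      MeasureTheory.volume 0 T :=
    (continuous_const.mul ((hc x u).mul (hc y v).star)).intervalIntegrable _ _
  have hsum (u : D.Idx) : IntervalIntegrable (fun t => ∑ v,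
      D.tilde B u v * (D.scaledExp T t x u * star (D.scaledExp T t y v)))
      MeasureTheory.volume 0 T :=
    (continuous_finsetSum _ fun v _ =>
      continuous_const.mul ((hc x u).mul (hc y v).star)).intervalIntegrable _ _
  simp_rw [← intervalIntegral.integral_const_mul]
  simp_rw [← intervalIntegral.integral_finsetSum fun v _ => hint _ v]
  rw [← intervalIntegral.integral_finsetSum fun u _ => hsum u]
  refine intervalIntegral.integral_congr fun t _ => ?_
  simp only [Matrix.mul_apply, Matrix.conjTranspose_apply, Finset.sum_mul]
  rw [Finset.sum_comm]
  exact Finset.sum_congr rfl fun u _ => Finset.sum_congr rfl fun v _ => by ring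

theorem tendsto_scaledGramian_apply_zero (B : Matrix (Fin n) (Fin n) ℂ) {x y : D.Idx}
    (h : ∀ u v, Tendsto (fun T => ∫ t in (0 : ℝ)..T,
      D.scaledExp T t x u * star (D.scaledExp T t y v)) atTop (𝓝 0)) :
    Tendsto (fun T => D.scaledGramian B T x y) atTop (𝓝 0) := by
  simp_rw [scaledGramian_apply]
  have : Tendsto (fun T => ∑ u, ∑ v, D.tilde B u v *
      ∫ t in (0 : ℝ)..T, D.scaledExp T t x u * star (D.scaledExp T t y v)) atTop
      (𝓝 (∑ u, ∑ v, D.tilde B u v * 0)) :=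
    tendsto_finsetSum _ fun u _ => tendsto_finsetSum _ fun v _ => (h u v).const_mul _
  simpa using this

theorem decaysForward_scaledExp (x : D.neg.Idx) (u : D.Idx) :
    DecaysForward fun T t => D.scaledExp T t (Sum.inl x) u := by
  rcases u with u | u
  · exact D.neg.decaysForward_expMat D.re_neg x u
  · exact ⟨0, 1, le_rfl, one_pos, fun T _ t _ _ => by simp [scaledExp]⟩

theorem decaysSqrt_scaledExp (x : D.zero.Idx) (u : D.Idx) :
    DecaysSqrt fun T t => D.scaledExp T t (Sum.inr (Sum.inl x)) u := by
  rcases u with u | u | u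
  · exact ⟨0, le_rfl, fun T _ t _ _ => by simp [scaledExp]⟩
  · exact D.zero.decaysSqrt_expMat D.re_zero x u
  · exact ⟨0, le_rfl, fun T _ t _ _ => by simp [scaledExp]⟩

theorem decaysBackward_scaledExp (x : D.pos.Idx) (u : D.Idx) :
    DecaysBackward fun T t => D.scaledExp T t (Sum.inr (Sum.inr x)) u := by
  rcases u with u | u | u
  · exact ⟨0, 1, le_rfl, one_pos, fun T _ t _ _ => by simp [scaledExp]⟩
  · exact ⟨0, 1, le_rfl, one_pos, fun T _ t _ _ => by simp [scaledExp]⟩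
  · exact D.pos.decaysBackward_expMat D.re_pos x u

theorem tendsto_scaledGramian_neg (B : Matrix (Fin n) (Fin n) ℂ) :
    Tendsto (fun T => (D.scaledGramian B T).toBlocks₁₁) atTop (𝓝 (D.WNeg B)) := by
  have hblock (T : ℝ) : (D.scaledGramian B T).toBlocks₁₁ = entrywiseIntegral (fun t =>
      D.neg.expMat (t - 0) * (D.tilde B).toBlocks₁₁ * (D.neg.expMat (t - 0))ᴴ) T := by
    ext i j
    simp [scaledGramian, entrywiseIntegral, Matrix.toBlocks₁₁, scaledExp, Matrix.mul_apply]
  simp_rw [hblock]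
  refine tendsto_choose_of_sylvester D.existsUnique_neg ?_
  simp_rw [JordanData.sylvester_gramIntegral]
  have hE : Tendsto (fun T => D.neg.expMat T) atTop (𝓝 0) := tendsto_matrix_iff.2 fun i j =>
    (D.neg.decaysForward_expMat D.re_neg i j).tendsto_diagonal
  -- The boundary term at `t = 0` cancels `B̃₋₋`; the one at `t = T` tends to zero.
  simpa [JordanData.expMat_zero] using
    tendsto_mul_mul_conjTranspose_zero hE (D.tilde B).toBlocks₁₁

theorem tendsto_scaledGramian_pos (B : Matrix (Fin n) (Fin n) ℂ) :
    Tendsto (fun T => (D.scaledGramian B T).toBlocks₂₂.toBlocks₂₂) atTop (𝓝 (D.WPos B)) := by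
  have hblock (T : ℝ) : (D.scaledGramian B T).toBlocks₂₂.toBlocks₂₂ = entrywiseIntegral (fun t =>
      D.pos.expMat (t - T) * (D.tilde B).toBlocks₂₂.toBlocks₂₂ * (D.pos.expMat (t - T))ᴴ) T := by
    ext i j
    simp [scaledGramian, entrywiseIntegral, Matrix.toBlocks₂₂, scaledExp, Matrix.mul_apply]
  simp_rw [hblock]
  refine tendsto_choose_of_sylvester D.existsUnique_pos ?_
  simp_rw [Matrix.neg_mul, Matrix.mul_neg, ← neg_add, JordanData.sylvester_gramIntegral]
  have hE : Tendsto (fun T => D.pos.expMat (-T)) atTop (𝓝 0) := tendsto_matrix_iff.2 fun i j => by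
    simpa using (D.pos.decaysBackward_expMat D.re_pos i j).tendsto_zero
  -- With the sign reversed and the shift `T`, the boundary term at `t = T` cancels `B̃₊₊`, and the
  -- one at `t = 0` tends to zero.
  simpa [JordanData.expMat_zero] using
    tendsto_mul_mul_conjTranspose_zero hE (D.tilde B).toBlocks₂₂.toBlocks₂₂

theorem tendsto_scaledGramian_zero (B : Matrix (Fin n) (Fin n) ℂ) (x y : D.zero.Idx) :
    Tendsto (fun T => D.scaledGramian B T (Sum.inr (Sum.inl x)) (Sum.inr (Sum.inl y))) atTop
      (𝓝 (D.WZero B x y)) := by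
  have hsum (T : ℝ) : D.scaledGramian B T (Sum.inr (Sum.inl x)) (Sum.inr (Sum.inl y)) =
      ∑ u, ∑ v, D.tilde B (Sum.inr (Sum.inl u)) (Sum.inr (Sum.inl v)) *
        ∫ t in (0 : ℝ)..T, (D.zero.rowScale T x * D.zero.expMat t x u) *
          star (D.zero.rowScale T y * D.zero.expMat t y v) := by
    rw [scaledGramian_apply]
    simp [scaledExp]
  simp_rw [hsum]
  refine (tendsto_finsetSum _ fun u _ => tendsto_finsetSum _ fun v _ =>
    (D.zero.tendsto_integral_rowScale D.re_zero x u y v).const_mul _).trans_eq ?_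
  congr 1
  -- Only the pair of last columns has a nonzero limit, which is why `W₀` sees only the lower-right
  -- entries of the blocks of `B̃`.
  rw [Finset.sum_eq_single (D.zero.last x.1), Finset.sum_eq_single (D.zero.last y.1)]
  · simp only [and_true, WZero, Matrix.of_apply, mul_ite, mul_zero]
    rfl
  · intro v _ hv
    simp [hv]
  · simp
  · intro u _ hu
    simp [hu]
  · simp

theorem tendsto_scaledGramian (B : Matrix (Fin n) (Fin n) ℂ) :
    Tendsto (fun T => D.scaledGramian B T) atTop (𝓝 (D.WInfOf B)) := by
  rw [tendsto_matrix_iff]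
  rintro (x | x | x) (y | y | y)
  · exact tendsto_matrix_iff.1 (D.tendsto_scaledGramian_neg B) x y
  · exact D.tendsto_scaledGramian_apply_zero B fun u v =>
      (D.decaysForward_scaledExp x u).tendsto_integral_mul_sqrt (D.decaysSqrt_scaledExp y v).star
  · exact D.tendsto_scaledGramian_apply_zero B fun u v =>
      (D.decaysForward_scaledExp x u).tendsto_integral_mul_backward
        (D.decaysBackward_scaledExp y v).star
  · exact D.tendsto_scaledGramian_apply_zero B fun u v =>
      ((D.decaysForward_scaledExp y v).star.tendsto_integral_mul_sqrt
        (D.decaysSqrt_scaledExp x u)).congr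
        fun T => intervalIntegral.integral_congr fun t _ => mul_comm _ _
  · exact D.tendsto_scaledGramian_zero B x y
  · exact D.tendsto_scaledGramian_apply_zero B fun u v =>
      ((D.decaysBackward_scaledExp y v).star.tendsto_integral_mul_sqrt
        (D.decaysSqrt_scaledExp x u)).congr
        fun T => intervalIntegral.integral_congr fun t _ => mul_comm _ _
  · exact D.tendsto_scaledGramian_apply_zero B fun u v =>
      ((D.decaysForward_scaledExp y v).star.tendsto_integral_mul_backward
        (D.decaysBackward_scaledExp x u)).congr
        fun T => intervalIntegral.integral_congr fun t _ => mul_comm _ _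
  · exact D.tendsto_scaledGramian_apply_zero B fun u v =>
      (D.decaysBackward_scaledExp x u).tendsto_integral_mul_sqrt (D.decaysSqrt_scaledExp y v).star
  · exact tendsto_matrix_iff.1 (D.tendsto_scaledGramian_pos B) x y

end JordanDecomposition

/-! ### The real Gramian -/

section Gramian

variable {n : ℕ} (A : Matrix (Fin n) (Fin n) ℝ)

theorem continuous_exp_smul_apply (i j : Fin n) :
    Continuous fun t : ℝ => NormedSpace.exp (t • A) i j :=
  continuous_iff_continuousAt.2 fun t => (hasDerivAt_exp_smul_apply A t i j).continuousAt

theorem gramian_integrand_apply (p : Fin n → ℝ) (t : ℝ) (i j : Fin n) :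
    (NormedSpace.exp (t • A) * Matrix.diagonal p * NormedSpace.exp (t • Aᵀ)) i j =
      ∑ k, p k * (NormedSpace.exp (t • A) i k * NormedSpace.exp (t • A) j k) := by
  rw [← Matrix.transpose_smul, Matrix.exp_transpose, Matrix.mul_apply]
  simp only [Matrix.mul_diagonal, Matrix.transpose_apply]
  exact Finset.sum_congr rfl fun k _ => by ring

theorem gramian_apply (p : Fin n → ℝ) (T : ℝ) (i j : Fin n) :
    gramian A p T i j = ∑ k, p k *
      ∫ t in (0 : ℝ)..T, NormedSpace.exp (t • A) i k * NormedSpace.exp (t • A) j k := by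
  have hc := continuous_exp_smul_apply A
  simp only [gramian, Matrix.of_apply, gramian_integrand_apply]
  rw [intervalIntegral.integral_finsetSum]
  · simp_rw [intervalIntegral.integral_const_mul]
  · exact fun k _ => (continuous_const.mul ((hc i k).mul (hc j k))).intervalIntegrable _ _

theorem continuous_gramian (T : ℝ) : Continuous fun p => gramian A p T := by
  refine continuous_matrix fun i j => ?_
  simp_rw [gramian_apply]
  fun_prop

theorem isHermitian_gramian (p : Fin n → ℝ) (T : ℝ) : (gramian A p T).IsHermitian := by
  ext i j
  simp only [Matrix.conjTranspose_apply, gramian_apply, star_trivial]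
  exact Finset.sum_congr rfl fun k _ => by simp_rw [mul_comm]

/-- The rate at which the Gramian's quadratic form grows with the horizon. -/
def gramianRate (p x : Fin n → ℝ) (t : ℝ) : ℝ :=
  ∑ k, p k * (∑ i, x i * NormedSpace.exp (t • A) i k) ^ 2

theorem continuous_gramianRate (p x : Fin n → ℝ) : Continuous (gramianRate A p x) := by
  have hc := continuous_exp_smul_apply A
  exact continuous_finsetSum _ fun k _ => continuous_const.mul
    ((continuous_finsetSum _ fun i _ => continuous_const.mul (hc i k)).pow 2)

theorem analyticAt_gramianRate (p x : Fin n → ℝ) (t : ℝ) :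
    AnalyticAt ℝ (gramianRate A p x) t := by
  have hc (i j : Fin n) := analyticAt_exp_smul_apply A t i j
  exact Finset.analyticAt_fun_sum _ fun k _ => analyticAt_const.mul
    ((Finset.analyticAt_fun_sum _ fun i _ => analyticAt_const.mul (hc i k)).pow 2)

theorem gramianRate_nonneg {p : Fin n → ℝ} (hp : ∀ k, 0 ≤ p k) (x : Fin n → ℝ) (t : ℝ) :
    0 ≤ gramianRate A p x t :=
  Finset.sum_nonneg fun k _ => mul_nonneg (hp k) (sq_nonneg _)

/-- Expanding the squares exhibits the Gramian's quadratic form as the integral of a nonnegative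
rate when `p ≥ 0`. -/
theorem integral_sum_mul_sq {E : ℝ → Matrix (Fin n) (Fin n) ℝ}
    (hE : ∀ i j, Continuous fun t => E t i j) (p x : Fin n → ℝ) (T : ℝ) :
    ∫ t in (0 : ℝ)..T, ∑ k, p k * (∑ i, x i * E t i k) ^ 2 =
      ∑ i, x i * ∑ j, (∑ k, p k * ∫ t in (0 : ℝ)..T, E t i k * E t j k) * x j := by
  have hrate (t : ℝ) : ∑ k, p k * (∑ i, x i * E t i k) ^ 2 = ∑ i, ∑ j, ∑ k,
      x i * x j * (p k * (E t i k * E t j k)) := by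
    simp_rw [sq, Finset.sum_mul_sum, Finset.mul_sum]
    rw [Finset.sum_comm]
    refine Finset.sum_congr rfl fun i _ => ?_
    rw [Finset.sum_comm]
    exact Finset.sum_congr rfl fun j _ => Finset.sum_congr rfl fun k _ => by ring
  simp_rw [hrate]
  rw [intervalIntegral.integral_finsetSum
    fun i _ => Continuous.intervalIntegrable (by fun_prop) _ _]
  refine Finset.sum_congr rfl fun i _ => ?_
  rw [intervalIntegral.integral_finsetSum
    fun i _ => Continuous.intervalIntegrable (by fun_prop) _ _, Finset.mul_sum]
  refine Finset.sum_congr rfl fun j _ => ?_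
  rw [intervalIntegral.integral_finsetSum
    fun i _ => Continuous.intervalIntegrable (by fun_prop) _ _, Finset.sum_mul, Finset.mul_sum]
  refine Finset.sum_congr rfl fun k _ => ?_
  simp_rw [intervalIntegral.integral_const_mul]
  ring

theorem dotProduct_gramian_mulVec (p x : Fin n → ℝ) (T : ℝ) :
    x ⬝ᵥ gramian A p T *ᵥ x = ∫ t in (0 : ℝ)..T, gramianRate A p x t := by
  simp only [gramianRate]
  rw [integral_sum_mul_sq (continuous_exp_smul_apply A)]
  simp only [dotProduct, Matrix.mulVec, gramian_apply]

theorem posSemidef_gramian {p : Fin n → ℝ} (hp : ∀ k, 0 ≤ p k) {T : ℝ} (hT : 0 ≤ T) :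
    (gramian A p T).PosSemidef := by
  refine .of_dotProduct_mulVec_nonneg (isHermitian_gramian A p T) fun x => ?_
  rw [star_trivial, dotProduct_gramian_mulVec]
  exact intervalIntegral.integral_nonneg hT fun t _ => gramianRate_nonneg A hp x t

/-- Controllability does not depend on the horizon. -/
theorem posDef_gramian_of_posDef {p : Fin n → ℝ} (hp : ∀ k, 0 ≤ p k) {S T : ℝ} (hT : 0 < T)
    (h : (gramian A p S).PosDef) : (gramian A p T).PosDef := by
  refine .of_dotProduct_mulVec_pos (isHermitian_gramian A p T) fun x hx => ?_
  rw [star_trivial, dotProduct_gramian_mulVec]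
  by_contra hle
  have hzero (t : ℝ) (ht : t ∈ Set.Icc 0 T) : gramianRate A p x t = 0 := by
    by_contra hne
    exact hle (intervalIntegral.integral_pos hT (continuous_gramianRate A p x).continuousOn
      (fun s _ => gramianRate_nonneg A hp x s)
      ⟨t, ht, lt_of_le_of_ne (gramianRate_nonneg A hp x t) (Ne.symm hne)⟩)
  -- The rate is analytic and vanishes near `T / 2`, hence everywhere, which contradicts positivity
  -- over the horizon `S`.
  have hall : Set.EqOn (gramianRate A p x) 0 Set.univ := by
    refine AnalyticOnNhd.eqOn_of_preconnected_of_eventuallyEq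
      (fun t _ => analyticAt_gramianRate A p x t) (fun t _ => analyticAt_const)
      isPreconnected_univ (Set.mem_univ (T / 2)) ?_
    filter_upwards [Icc_mem_nhds (show 0 < T / 2 by linarith) (show T / 2 < T by linarith)]
      with t ht
    exact hzero t ht
  have hpos := h.dotProduct_mulVec_pos hx
  rw [star_trivial, dotProduct_gramian_mulVec,
    intervalIntegral.integral_congr (g := 0) fun t _ => hall (Set.mem_univ t)] at hpos
  simp at hpos

end Gramian

/-- A decomposition into real rank-one terms `v vᵀ` remains one of the form `v v*` over `ℂ`. -/
theorem Matrix.PosSemidef.map_ofReal {ι : Type*} [Fintype ι] {M : Matrix ι ι ℝ}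
    (hM : M.PosSemidef) : (M.map (fun x : ℝ => (x : ℂ))).PosSemidef := by
  classical
  obtain ⟨m, v, rfl⟩ := Matrix.posSemidef_iff_eq_sum_vecMulVec.1 hM
  have : (∑ k, vecMulVec (v k) (star (v k))).map (fun x : ℝ => (x : ℂ)) =
      ∑ k, vecMulVec (fun i => (v k i : ℂ)) (star fun i => (v k i : ℂ)) := by
    ext i j
    simp [Matrix.sum_apply, Matrix.vecMulVec_apply]
  rw [this]
  exact Matrix.posSemidef_sum _ fun k _ => Matrix.posSemidef_vecMulVec_self_star _

theorem isClosed_posSemidef {ι : Type*} [Fintype ι] :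
    IsClosed {M : Matrix ι ι ℂ | M.PosSemidef} := by
  simp_rw [Matrix.posSemidef_iff_dotProduct_mulVec, Matrix.IsHermitian, Set.ofPred_and,
    Set.ofPred_forall]
  refine (isClosed_eq (by fun_prop) continuous_id).inter (isClosed_iInter fun x => ?_)
  exact isClosed_le continuous_const (by fun_prop)

namespace JordanDecomposition

variable {n : ℕ} {A : Matrix (Fin n) (Fin n) ℝ} (D : JordanDecomposition A)

/-! ### The scaled Gramian is congruent to the real Gramian -/

/-- The row scaling that turns `exp (t J)` into `scaledExp T t`. -/
def rowScaling (T : ℝ) : Matrix D.Idx D.Idx ℂ :=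
  Matrix.fromBlocks 1 0 0 (Matrix.fromBlocks
    (Matrix.diagonal fun x => (D.zero.rowScale T x : ℂ)) 0 0 (D.pos.expMat (-T)))

theorem exists_rowScaling_mul_eq_one {T : ℝ} (hT : 0 < T) :
    ∃ S : Matrix D.Idx D.Idx ℂ, D.rowScaling T * S = 1 := by
  refine ⟨Matrix.fromBlocks 1 0 0 (Matrix.fromBlocks
    (Matrix.diagonal fun x => ((D.zero.rowScale T x : ℂ))⁻¹) 0 0 (D.pos.expMat T)), ?_⟩
  have h1 (x : D.zero.Idx) : (D.zero.rowScale T x : ℂ) ≠ 0 := by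
    exact_mod_cast (D.zero.rowScale_pos hT x).ne'
  simp [rowScaling, Matrix.fromBlocks_multiply, ← JordanData.expMat_add, JordanData.expMat_zero, h1]

/-- The change of coordinates from the state space to the scaled Jordan coordinates. -/
def scaledCoords (T : ℝ) : Matrix D.Idx (Fin n) ℂ :=
  D.rowScaling T * D.Qinv

theorem exists_scaledCoords_mul_eq_one {T : ℝ} (hT : 0 < T) :
    ∃ R : Matrix (Fin n) D.Idx ℂ, D.scaledCoords T * R = 1 := by
  obtain ⟨S, hS⟩ := D.exists_rowScaling_mul_eq_one hT
  refine ⟨D.Q * S, ?_⟩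
  rw [scaledCoords, Matrix.mul_assoc, ← Matrix.mul_assoc D.Qinv, D.Qinv_mul_Q, Matrix.one_mul, hS]

/-- Both sides solve `E' = E J`, `E 0 = 1`. -/
theorem fromBlocks_expMat_eq (t : ℝ) :
    Matrix.fromBlocks (D.neg.expMat t) 0 0
      (Matrix.fromBlocks (D.zero.expMat t) 0 0 (D.pos.expMat t)) =
    D.Qinv * (NormedSpace.exp (t • A)).map (fun x : ℝ => (x : ℂ)) * D.Q := by
  have hJ := D.conj_eq
  set J := Matrix.fromBlocks D.neg.mat 0 0 (Matrix.fromBlocks D.zero.mat 0 0 D.pos.mat) with hJdef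
  rw [eq_exp_smul_of_hasEntrywiseDerivAt (M := J)
      (E := fun t => D.Qinv * (NormedSpace.exp (t • A)).map (fun x : ℝ => (x : ℂ)) * D.Q) ?_ ?_ t,
    eq_exp_smul_of_hasEntrywiseDerivAt (M := J) (E := fun t => Matrix.fromBlocks (D.neg.expMat t) 0 0
      (Matrix.fromBlocks (D.zero.expMat t) 0 0 (D.pos.expMat t))) ?_ ?_ t]
  · intro t
    rw [hJdef]
    simp only [Matrix.fromBlocks_multiply, Matrix.mul_zero, Matrix.zero_mul, add_zero, zero_add]
    rintro (x | x | x) (y | y | y)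
    · exact D.neg.hasEntrywiseDerivAt_expMat t x y
    · exact hasDerivAt_const t 0
    · exact hasDerivAt_const t 0
    · exact hasDerivAt_const t 0
    · exact D.zero.hasEntrywiseDerivAt_expMat t x y
    · exact hasDerivAt_const t 0
    · exact hasDerivAt_const t 0
    · exact hasDerivAt_const t 0
    · exact D.pos.hasEntrywiseDerivAt_expMat t x y
  · simp [JordanData.expMat_zero]
  · intro t
    have h1 : HasEntrywiseDerivAt (fun t : ℝ => (NormedSpace.exp (t • A)).map (fun x : ℝ => (x : ℂ)))
        ((NormedSpace.exp (t • A)).map (fun x : ℝ => (x : ℂ)) * A.map (fun x : ℝ => (x : ℂ))) t := by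
      intro i j
      have h := (hasDerivAt_exp_smul_apply A t i j).ofReal_comp
      refine h.congr_deriv ?_
      simp [Matrix.mul_apply]
    have h2 := (h1.const_mul D.Qinv).mul_const D.Q
    rw [← hJ]
    convert h2 using 1
    simp only [Matrix.mul_assoc]
    rw [← Matrix.mul_assoc D.Q, D.Q_mul_Qinv, Matrix.one_mul]
  · simp [D.Qinv_mul_Q, Matrix.map_one]

theorem scaledExp_eq (T t : ℝ) :
    D.scaledExp T t =
      D.scaledCoords T * (NormedSpace.exp (t • A)).map (fun x : ℝ => (x : ℂ)) * D.Q := by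
  have hdiag : Matrix.of (fun x y => (D.zero.rowScale T x : ℂ) * D.zero.expMat t x y) =
      Matrix.diagonal (fun x => (D.zero.rowScale T x : ℂ)) * D.zero.expMat t := by
    ext x y
    simp [Matrix.diagonal_mul]
  rw [scaledCoords, Matrix.mul_assoc, Matrix.mul_assoc, ← Matrix.mul_assoc D.Qinv,
    ← fromBlocks_expMat_eq, scaledExp, rowScaling, hdiag, sub_eq_neg_add, JordanData.expMat_add]
  simp [Matrix.fromBlocks_multiply]

/-- The outer `Q` and `Q*` cancel the `Q⁻¹` and `Q⁻*` in `B̃`; since `A` is real, `exp (t Aᵀ)`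
becomes the conjugate transpose of `exp (t A)`. -/
theorem scaledGramian_diagonal (p : Fin n → ℝ) (T : ℝ) :
    D.scaledGramian (Matrix.diagonal fun i => (p i : ℂ)) T =
      D.scaledCoords T * (gramian A p T).map (fun x : ℝ => (x : ℂ)) * (D.scaledCoords T)ᴴ := by
  have hgram : (gramian A p T).map (fun x : ℝ => (x : ℂ)) = entrywiseIntegral (fun t =>
      (NormedSpace.exp (t • A) * Matrix.diagonal p * NormedSpace.exp (t • Aᵀ)).map
        (fun x : ℝ => (x : ℂ))) T := by
    ext i j
    simp only [entrywiseIntegral, gramian, Matrix.map_apply, Matrix.of_apply]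
    rw [intervalIntegral.integral_ofReal]
  have hcont : Continuous fun t : ℝ =>
      (NormedSpace.exp (t • A) * Matrix.diagonal p * NormedSpace.exp (t • Aᵀ)).map
        (fun x : ℝ => (x : ℂ)) := by
    have hc := continuous_exp_smul_apply A
    refine continuous_matrix fun i j => ?_
    simp only [Matrix.map_apply, gramian_integrand_apply]
    exact Complex.continuous_ofReal.comp (continuous_finsetSum _ fun k _ =>
      continuous_const.mul ((hc i k).mul (hc j k)))
  rw [hgram, const_mul_entrywiseIntegral _ hcont,
    entrywiseIntegral_mul_const _ (continuous_const.matrix_mul hcont), scaledGramian]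
  congr 1
  ext1 t
  have hmap : (NormedSpace.exp (t • A) * Matrix.diagonal p * NormedSpace.exp (t • Aᵀ)).map
      (fun x : ℝ => (x : ℂ)) = (NormedSpace.exp (t • A)).map (fun x : ℝ => (x : ℂ)) *
        Matrix.diagonal (fun i => (p i : ℂ)) *
          ((NormedSpace.exp (t • A)).map (fun x : ℝ => (x : ℂ)))ᴴ := by
    rw [← Matrix.transpose_smul, Matrix.exp_transpose]
    ext i j
    simp [Matrix.mul_apply, Matrix.diagonal_apply]
  have hQ : D.Qinvᴴ * D.Qᴴ = 1 := by
    rw [← Matrix.conjTranspose_mul, D.Q_mul_Qinv, Matrix.conjTranspose_one]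
  rw [scaledExp_eq, hmap, tilde]
  simp only [Matrix.conjTranspose_mul, Matrix.mul_assoc]
  rw [← Matrix.mul_assoc D.Q D.Qinv, D.Q_mul_Qinv, Matrix.one_mul, ← Matrix.mul_assoc D.Qinvᴴ, hQ,
    Matrix.one_mul]

/-- The determinants of the scaled and of the real Gramian differ by a positive factor that does
not depend on the input vector. -/
theorem exists_det_scaledGramian_eq {T : ℝ} (hT : 0 < T) :
    ∃ c : ℝ, 0 < c ∧ ∀ p : Fin n → ℝ,
      (D.scaledGramian (Matrix.diagonal fun i => (p i : ℂ)) T).det =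
        (c * (gramian A p T).det : ℝ) := by
  obtain ⟨R, hR⟩ := D.exists_scaledCoords_mul_eq_one hT
  have hcard : Fintype.card (Fin n) = Fintype.card D.Idx :=
    Matrix.square_of_invertible D.Q D.Qinv D.Q_mul_Qinv D.Qinv_mul_Q
  -- The coordinate change is indexed by two different types, so it is reindexed to have a
  -- determinant; the factor is then `|det S|²`.
  let e : D.Idx ≃ Fin n := (Fintype.equivOfCardEq hcard).symm
  let S : Matrix (Fin n) (Fin n) ℂ := (D.scaledCoords T).submatrix e.symm id
  have hS : S.det ≠ 0 := by
    have h1 : S * R.submatrix id e.symm = 1 := by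
      rw [← Matrix.submatrix_mul _ _ _ _ _ Function.bijective_id, hR]
      simp
    intro h0
    have h2 := congrArg Matrix.det h1
    rw [Matrix.det_mul, h0, zero_mul, Matrix.det_one] at h2
    exact zero_ne_one h2
  refine ⟨Complex.normSq S.det, Complex.normSq_pos.2 hS, fun p => ?_⟩
  have hsub : (D.scaledGramian (Matrix.diagonal fun i => (p i : ℂ)) T).submatrix e.symm e.symm =
      S * (gramian A p T).map (fun x : ℝ => (x : ℂ)) * Sᴴ := by
    rw [scaledGramian_diagonal, Matrix.conjTranspose_submatrix,
      Matrix.submatrix_mul _ _ _ id _ Function.bijective_id,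
      Matrix.submatrix_mul _ _ _ id _ Function.bijective_id, Matrix.submatrix_id_id]
  have hdet : ((gramian A p T).map (fun x : ℝ => (x : ℂ))).det = ((gramian A p T).det : ℂ) :=
    (RingHom.map_det Complex.ofRealHom _).symm
  rw [← Matrix.det_submatrix_equiv_self e.symm, hsub, Matrix.det_mul, Matrix.det_mul, hdet,
    Matrix.det_conjTranspose, Complex.ofReal_mul, Complex.normSq_eq_conj_mul_self, Complex.star_def]
  ring

end JordanDecomposition

/-! ### Log-determinant problems as determinant maximization on the simplex -/

/-- Minimizing `-log g` where `g` is positive amounts to maximizing `g`. -/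
theorem isMinOn_neg_log_iff {X : Type*} {K F : Set X} {g : X → ℝ} {p : X}
    (hF : ∀ q, q ∈ F ↔ q ∈ K ∧ 0 < g q) :
    (p ∈ F ∧ IsMinOn (fun q => -Real.log (g q)) F p) ↔ p ∈ K ∧ 0 < g p ∧ IsMaxOn g K p := by
  constructor
  · rintro ⟨hpF, hmin⟩
    obtain ⟨hpK, hp⟩ := (hF p).1 hpF
    refine ⟨hpK, hp, fun q hq => ?_⟩
    rcases le_or_gt (g q) 0 with h | h
    · exact h.trans hp.le
    · have := hmin ((hF q).2 ⟨hq, h⟩)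
      simp only [Set.mem_ofPred_eq, neg_le_neg_iff] at this
      exact (Real.log_le_log_iff h hp).1 this
  · rintro ⟨hpK, hp, hmax⟩
    refine ⟨(hF p).2 ⟨hpK, hp⟩, fun q hq => ?_⟩
    obtain ⟨hqK, hq⟩ := (hF q).1 hq
    exact neg_le_neg (Real.log_le_log hq (hmax hqK))

section FiniteHorizon

variable {n : ℕ} (A : Matrix (Fin n) (Fin n) ℝ)

/-- A positive semidefinite matrix is definite exactly when its determinant is nonzero. -/
theorem mem_vcsFeasible_iff {T : ℝ} (hT : 0 ≤ T) (p : Fin n → ℝ) :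
    p ∈ vcsFeasible A T ↔ p ∈ stdSimplex ℝ (Fin n) ∧ 0 < (gramian A p T).det := by
  refine and_congr_right fun hp => ⟨fun h => h.det_pos, fun h => ?_⟩
  exact (posSemidef_gramian A hp.1 hT).posDef_iff_det_ne_zero.2 h.ne'

theorem isVCS_iff {T : ℝ} (hT : 0 ≤ T) (p : Fin n → ℝ) :
    IsVCS A T p ↔ p ∈ stdSimplex ℝ (Fin n) ∧ 0 < (gramian A p T).det ∧
      IsMaxOn (fun q => (gramian A q T).det) (stdSimplex ℝ (Fin n)) p :=
  isMinOn_neg_log_iff (mem_vcsFeasible_iff A hT)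

theorem exists_isVCS {T : ℝ} (hT : 0 ≤ T) (h : (vcsFeasible A T).Nonempty) :
    ∃ p, IsVCS A T p := by
  obtain ⟨q, hq⟩ := h
  rw [mem_vcsFeasible_iff A hT] at hq
  obtain ⟨p, hp, hmax⟩ := (isCompact_stdSimplex ℝ (Fin n)).exists_isMaxOn ⟨q, hq.1⟩
    (continuous_gramian A T).matrix_det.continuousOn
  exact ⟨p, (isVCS_iff A hT p).2 ⟨hp, hq.2.trans_le (hmax hq.1), hmax⟩⟩

end FiniteHorizon

/-! ### Passage to the infinite horizon -/

namespace JordanDecomposition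

variable {n : ℕ} {A : Matrix (Fin n) (Fin n) ℝ} (D : JordanDecomposition A)

/-- The scaled Gramian of the input vector `p`. -/
def scaledW (p : Fin n → ℝ) (T : ℝ) : Matrix D.Idx D.Idx ℂ :=
  D.scaledGramian (Matrix.diagonal fun i => (p i : ℂ)) T

theorem tendsto_scaledW (p : Fin n → ℝ) : Tendsto (D.scaledW p) atTop (𝓝 (D.WInf p)) :=
  D.tendsto_scaledGramian _

/-- Only the finitely many coefficients at the standard basis vectors depend on `T`, so pointwise
convergence already gives joint convergence. -/
theorem scaledW_apply (p : Fin n → ℝ) (T : ℝ) (x y : D.Idx) :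
    D.scaledW p T x y = ∑ k, (p k : ℂ) * D.scaledW (Pi.single k 1) T x y := by
  have htilde (p : Fin n → ℝ) (u v : D.Idx) :
      D.tilde (Matrix.diagonal fun i => (p i : ℂ)) u v =
        ∑ k, (p k : ℂ) * (D.Qinv u k * star (D.Qinv v k)) := by
    rw [tilde, Matrix.mul_apply]
    simp only [Matrix.mul_diagonal, Matrix.conjTranspose_apply]
    exact Finset.sum_congr rfl fun k _ => by ring
  have hsingle (k : Fin n) (u v : D.Idx) :
      D.tilde (Matrix.diagonal fun i => ((Pi.single k 1 : Fin n → ℝ) i : ℂ)) u v =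
        D.Qinv u k * star (D.Qinv v k) := by
    rw [htilde, Finset.sum_eq_single k] <;> simp +contextual
  simp only [scaledW, scaledGramian_apply, hsingle, htilde p, Finset.sum_mul, Finset.mul_sum]
  symm
  rw [Finset.sum_comm]
  refine Finset.sum_congr rfl fun u _ => ?_
  rw [Finset.sum_comm]
  exact Finset.sum_congr rfl fun v _ => Finset.sum_congr rfl fun k _ => by ring

/-- The scaled Gramians converge jointly in the horizon and the input vector. -/
theorem tendsto_scaledW_of_tendsto {l : Filter ℝ} (hl : l ≤ atTop) {P : ℝ → Fin n → ℝ}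
    {q : Fin n → ℝ} (hP : Tendsto P l (𝓝 q)) :
    Tendsto (fun T => D.scaledW (P T) T) l (𝓝 (D.WInf q)) := by
  have hlim (P : ℝ → Fin n → ℝ) {l : Filter ℝ} (hl : l ≤ atTop) (hP : Tendsto P l (𝓝 q))
      (x y : D.Idx) : Tendsto (fun T => D.scaledW (P T) T x y) l
        (𝓝 (∑ k, (q k : ℂ) * D.WInf (Pi.single k 1) x y)) := by
    simp_rw [fun T => D.scaledW_apply (P T) T x y]
    refine tendsto_finsetSum _ fun k _ => ?_
    exact ((Complex.continuous_ofReal.tendsto _).comp (tendsto_pi_nhds.1 hP k)).mul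
      ((tendsto_matrix_iff.1 (D.tendsto_scaledW _) x y).mono_left hl)
  refine tendsto_matrix_iff.2 fun x y => ?_
  -- The constant family `q` identifies the limit; linearity of `W_∞` need not be proved separately.
  rw [tendsto_nhds_unique (tendsto_matrix_iff.1 (D.tendsto_scaledW q) x y)
    (hlim (fun _ => q) le_rfl tendsto_const_nhds x y)]
  exact hlim P hl hP x y

theorem tendsto_det_scaledW_of_tendsto {l : Filter ℝ} (hl : l ≤ atTop) {P : ℝ → Fin n → ℝ}
    {q : Fin n → ℝ} (hP : Tendsto P l (𝓝 q)) :
    Tendsto (fun T => (D.scaledW (P T) T).det.re) l (𝓝 (D.WInf q).det.re) := by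
  have hc : Continuous fun M : Matrix D.Idx D.Idx ℂ => M.det.re :=
    Complex.continuous_re.comp (continuous_id.matrix_det)
  exact (hc.tendsto _).comp (D.tendsto_scaledW_of_tendsto hl hP)

theorem posSemidef_WInf {p : Fin n → ℝ} (hp : ∀ k, 0 ≤ p k) : (D.WInf p).PosSemidef := by
  refine isClosed_posSemidef.mem_of_tendsto (D.tendsto_scaledW p) ?_
  filter_upwards [eventually_ge_atTop (0 : ℝ)] with T hT
  rw [scaledW, scaledGramian_diagonal]
  exact (posSemidef_gramian A hp hT).map_ofReal.mul_mul_conjTranspose_same _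

theorem mem_feasible_iff (p : Fin n → ℝ) :
    p ∈ D.feasible ↔ p ∈ stdSimplex ℝ (Fin n) ∧ 0 < (D.WInf p).det.re := by
  refine and_congr_right fun hp => ⟨fun h => (Complex.pos_iff.1 h.det_pos).1, fun h => ?_⟩
  refine (D.posSemidef_WInf hp.1).posDef_iff_det_ne_zero.2 fun h0 => ?_
  rw [h0] at h
  exact lt_irrefl _ h

theorem isInfVCS_iff (p : Fin n → ℝ) :
    D.IsInfVCS p ↔ p ∈ stdSimplex ℝ (Fin n) ∧ 0 < (D.WInf p).det.re ∧
      IsMaxOn (fun q => (D.WInf q).det.re) (stdSimplex ℝ (Fin n)) p :=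
  isMinOn_neg_log_iff D.mem_feasible_iff

theorem exists_det_scaledW_re_eq {T : ℝ} (hT : 0 < T) :
    ∃ c : ℝ, 0 < c ∧ ∀ p : Fin n → ℝ, (D.scaledW p T).det.re = c * (gramian A p T).det := by
  obtain ⟨c, hc, h⟩ := D.exists_det_scaledGramian_eq hT
  exact ⟨c, hc, fun p => by rw [scaledW, h, Complex.ofReal_re]⟩

/-- An input vector that is feasible for the infinite horizon is feasible for every horizon. -/
theorem mem_vcsFeasible_of_mem_feasible {p : Fin n → ℝ} (hp : p ∈ D.feasible) {T : ℝ}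
    (hT : 0 < T) : p ∈ vcsFeasible A T := by
  have hp' := (D.mem_feasible_iff p).1 hp
  have hlim := D.tendsto_det_scaledW_of_tendsto le_rfl (tendsto_const_nhds (x := p))
  -- Convergence only provides some horizon `S` with positive determinant; horizon independence
  -- carries definiteness over to `T`.
  obtain ⟨S, hdet, hS⟩ := ((hlim.eventually_const_lt hp'.2).and (eventually_gt_atTop 0)).exists
  obtain ⟨c, hc, h⟩ := D.exists_det_scaledW_re_eq hS
  rw [h] at hdet
  have hfeas := (mem_vcsFeasible_iff A hS.le p).2 ⟨hp.1, (pos_iff_pos_of_mul_pos hdet).1 hc⟩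
  exact ⟨hp.1, posDef_gramian_of_posDef A hp.1.1 hT hfeas.2⟩

/-- Cluster points of finite-horizon optimal solutions solve the infinite-horizon problem. -/
theorem isInfVCS_of_mapClusterPt (hne : D.feasible.Nonempty) {pT : ℝ → Fin n → ℝ}
    (hpT : ∀ T : ℝ, 0 < T → IsVCS A T (pT T)) {q : Fin n → ℝ} (hq : q ∈ stdSimplex ℝ (Fin n))
    (hclust : MapClusterPt q atTop pT) : D.IsInfVCS q := by
  -- The ultrafilter plays the role of a subsequence of horizons along which the optima converge to
  -- `q`.
  obtain ⟨U, hU, hlim⟩ := mapClusterPt_iff_ultrafilter.1 hclust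
  have hmax : IsMaxOn (fun q => (D.WInf q).det.re) (stdSimplex ℝ (Fin n)) q := by
    intro r hr
    refine le_of_tendsto_of_tendsto (D.tendsto_det_scaledW_of_tendsto hU (tendsto_const_nhds (x := r)))
      (D.tendsto_det_scaledW_of_tendsto hU hlim) ?_
    filter_upwards [hU (eventually_gt_atTop (0 : ℝ))] with T hT
    obtain ⟨c, hc, h⟩ := D.exists_det_scaledW_re_eq hT
    -- The same factor `c` occurs on both sides, so finite-horizon optimality applies directly.
    rw [h, h]
    exact mul_le_mul_of_nonneg_left (((isVCS_iff A hT.le _).1 (hpT T hT)).2.2 hr) hc.le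
  obtain ⟨r, hr⟩ := hne
  rw [mem_feasible_iff] at hr
  exact (D.isInfVCS_iff q).2 ⟨hq, hr.2.trans_le (hmax hr.1), hmax⟩

end JordanDecomposition

end

theorem mainTheorem2 {n : ℕ} (A : Matrix (Fin n) (Fin n) ℝ) (D : JordanDecomposition A)
    (pInf : Fin n → ℝ) (hopt : D.IsInfVCS pInf)
    (huniq : ∀ q : Fin n → ℝ, D.IsInfVCS q → q = pInf) :
    (∀ T : ℝ, 0 < T → ∃ p : Fin n → ℝ, IsVCS A T p) ∧
      ∀ pT : ℝ → Fin n → ℝ, (∀ T : ℝ, 0 < T → IsVCS A T (pT T)) →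
        Tendsto pT atTop (𝓝 pInf) := by
  refine ⟨fun T hT => exists_isVCS A hT.le
    ⟨pInf, D.mem_vcsFeasible_of_mem_feasible hopt.1 hT⟩, fun pT hpT => ?_⟩
  refine (isCompact_stdSimplex ℝ (Fin n)).tendsto_nhds_of_unique_mapClusterPt ?_ fun q hq hclust =>
    huniq q (D.isInfVCS_of_mapClusterPt ⟨pInf, hopt.1⟩ hpT hq hclust)
  filter_upwards [eventually_gt_atTop (0 : ℝ)] with T hT
  exact (hpT T hT).1.1
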